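/- **Theorem (Adequacy for Fitch–Prawitz naive set theory).** *The logic.* Individual terms $T$ and formulas $A$ are given by $T ::= x \mid \lambda x.A$ and $A ::= p \mid T\in T \mid A\supset A$, where $x$ ranges over individual variables (bound by $\lambda$) and $p$ over propositional letters; formulas are taken up to $\alpha$-equivalence. A *quasi-deduction* is a natural deduction built from assumptions with the rules $$\frac{\Gamma,A\vdash B}{\Gamma\vdash A\supset B}\quad \frac{\Gamma\vdash A\quad \Gamma\vdash A\supset B}{\Gamma\vdash B}\quad \frac{\Gamma\vdash A[T/x]}{\Gamma\vdash T\in\lambda x.A}\quad \frac{\Gamma\vdash T\in\lambda x.A}{\Gamma\vdash A[T/x]}.$$ It is *normalizable* if some sequence of the usual reductions (removing an elimination whose major premise is the conclusion of the corresponding introduction, anywhere in the deduction) leads to a normal deduction, i.e. one with no such elimination. $B_1,\dots,B_m\vdash_{\mathsf{FPST}}A$ means that there is a normalizable quasi-deduction of $A$ from the assumptions $B_1,\dots,B_m$. *The framework.* The canonical logical framework with locks has kinds $K::=\mathsf{Type}\mid \Pi x{:}\sigma.K$, atomic families $\alpha::=a\mid\alpha N$, canonical families $\sigma::=\alpha\mid\Pi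 x{:}\sigma.\tau\mid\mathcal L^{P}_{N,\sigma}[\rho]$, atomic objects $A::=c\mid x\mid A\,M\mid\mathcal U^{P}_{N,\sigma}[A]$ and canonical objects $M::=A\mid\lambda x{:}\sigma.M\mid\mathcal L^{P}_{N,\sigma}[M]$. Its judgements are $\Sigma\ \mathsf{sig}$, $\vdash_\Sigma\Gamma$, $\Gamma\vdash_\Sigma K$, $\Gamma\vdash_\Sigma\sigma\ \mathsf{Type}$, $\Gamma\vdash_\Sigma\alpha\Rightarrow K$, $\Gamma\vdash_\Sigma A\Rightarrow\sigma$ and $\Gamma\vdash_\Sigma M\Leftarrow\sigma$. Their rules are those of canonical LF, in which applications are typed by hereditary substitution and an atomic object checks only against an atomic family, together with these rules, where $\tau^-$ is the erasure of $\tau$ to a simple type and $x$ does not occur in $S,\sigma$: - if $\Gamma\vdash\rho\ \mathsf{Type}$ and $\Gamma\vdash N\Leftarrow\sigma$, then $\Gamma\vdash\mathcal L^P_{N,\sigma}[\rho]\ \mathsf{Type}$; - if $\Gamma\vdash M\Leftarrow\rho$ and $\Gamma\vdash N\Leftarrow\sigma$, then $\Gamma\vdash\mathcal L^P_{N,\sigma}[M]\Leftarrow\mathcal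 L^P_{N,\sigma}[\rho]$; - if $\Gamma\vdash A\Rightarrow\mathcal L^P_{N,\sigma}[\rho]$, $\Gamma\vdash N\Leftarrow\sigma$ and $P(\Gamma\vdash_\Sigma N\Leftarrow\sigma)$ holds, then $\Gamma\vdash\mathcal U^P_{N,\sigma}[A]\Rightarrow\rho$; - if $\Gamma,x{:}\tau\vdash\mathcal L^P_{S,\sigma}[\rho]\ \mathsf{Type}$, $\Gamma\vdash A\Rightarrow\mathcal L^P_{S,\sigma}[\tau]$ and $\rho[\mathcal U^P_{S,\sigma}[A]/x]_{\tau^-}=\rho'$, then $\Gamma\vdash\mathcal L^P_{S,\sigma}[\rho']\ \mathsf{Type}$; - if $\Gamma,x{:}\tau\vdash\mathcal L^P_{S,\sigma}[M]\Leftarrow\mathcal L^P_{S,\sigma}[\rho]$, $\Gamma\vdash A\Rightarrow\mathcal L^P_{S,\sigma}[\tau]$, $\rho[\mathcal U^P_{S,\sigma}[A]/x]_{\tau^-}=\rho'$ and $M[\mathcal U^P_{S,\sigma}[A]/x]_{\tau^-}=M'$, then $\Gamma\vdash\mathcal L^P_{S,\sigma}[M']\Leftarrow\mathcal L^P_{S,\sigma}[\rho']$.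 Hereditary substitution acts componentwise, also on type annotations, and contracts the redexes it creates: substitution into $A\,M$ and into $\mathcal U^P_{N,\sigma}[A]$, where $A$ becomes $\lambda y{:}\tau.M_1$, respectively $\mathcal L^P_{N',\sigma'}[M_1]$ with $N',\sigma'$ the results of substitution into $N,\sigma$, gives $M_1[M'/y]_{\tau^-}$ ($M'$ being the result of substitution into $M$), respectively $M_1$. *The signature* $\Sigma_{\mathsf{FPST}}$ declares $o,\iota:\mathsf{Type}$; $T,V:o\to\mathsf{Type}$; $\mathsf{lam}:(\iota\to o)\to\iota$; $\epsilon:\iota\to\iota\to o$; ${\supset}:o\to o\to o$; $$\begin{aligned} \delta&:\Pi A{:}o.\,V(A)\to T(A),\\ \lambda_{\mathrm{intro}}&:\Pi A{:}\iota\to o.\,\Pi x{:}\iota.\,T(A\,x)\to T(\epsilon\,x\,(\mathsf{lam}\,\lambda z{:}\iota.A\,z)),\\ \lambda_{\mathrm{elim}}&:\Pi A{:}\iota\to o.\,\Pi x{:}\iota.\,T(\epsilon\,x\,(\mathsf{lam}\,\lambda z{:}\iota.A\,z))\to T(A\,x),\\ {\supset}_{\mathrm{intro}}&:\Pi A,B{:}o.\,(V(A)\to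 T(B))\to T(A\supset B),\\ {\supset}_{\mathrm{elim}}&:\Pi A,B{:}o.\,\Pi x{:}T(A).\,\Pi y{:}T(A\supset B).\ \mathcal L^{\mathrm{Fitch}}_{\langle x,y\rangle,\;T(A)\times T(A\supset B)}[T(B)], \end{aligned}$$ where $\sigma\times\tau=(\sigma\to\tau\to o)\to o$ and $\langle x,y\rangle=\lambda u{:}(\sigma\to\tau\to o).\,u\,x\,y$. An object built from $\delta\,A\,v$ ($v$ a variable), $\lambda_{\mathrm{intro}}$, $\lambda_{\mathrm{elim}}$, ${\supset}_{\mathrm{intro}}$ and unlocked ${\supset}_{\mathrm{elim}}$ represents a tree of inferences in which $\delta\,A\,v$ is the use of the assumption $v$; it is *normalizable* if the represented proof is. The predicate $\mathrm{Fitch}(\Gamma\vdash_\Sigma\langle x,y\rangle\Leftarrow T(A)\times T(A\supset B))$ holds iff there are a context $\Delta$ in which every type is $o$ or some $V(E)$, objects $X,Y$ with $\Delta\vdash_\Sigma X\Leftarrow T(C)$ and $\Delta\vdash_\Sigma Y\Leftarrow T(C\supset D)$ for some $C,D$ (typed without checking the predicates in the locks again), such that $x$ and $y$ arise from $X$ and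 $Y$ by one substitution of atomic objects for the variables of $\Delta$, and the proof that combines those represented by $X$ and $Y$ by $\supset$-elimination is normalizable. *Statement.* Let $B_1,\dots,B_m,A$ be formulas without free individual variables, and let $A_1,\dots,A_n$ be the distinct propositional letters that occur in them. Then $B_1,\dots,B_m\vdash_{\mathsf{FPST}}A$ if and only if there is a normalizable canonical object $M$ such that $$A_1{:}o,\dots,A_n{:}o,\;x_1{:}V(B_1),\dots,x_m{:}V(B_m)\ \vdash_{\Sigma_{\mathsf{FPST}}}\ M\Leftarrow T(A),$$ where in this judgement $A$ and $B_i$ stand for their encodings: the letter $A_i$ is encoded by the variable $A_i$, individual variables by variables of type $\iota$, $\lambda x.A$ by $\mathsf{lam}(\lambda x{:}\iota.A)$, $T\in S$ by $\epsilon\,T\,S$, and $A\supset B$ by ${\supset}\,A\,B$. -/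

import Mathlib

/- Conventions.  All syntax with binders is in de Bruijn form, so that `α`-equivalence is equality and
the hygiene condition on bound variables is built in.  All contexts (and signatures) are lists whose
head is the most recent declaration; variable `i` refers to entry number `i` of the list. -/

/-- Extension of a renaming under one binder. -/
def liftRen (ξ : ℕ → ℕ) : ℕ → ℕ
  | 0 => 0
  | n + 1 => ξ n + 1

/-! ## The canonical logical framework with locks -/

namespace CLLFP

/-- The names of family constants, of object constants and of lock predicates. -/
structure Names where
  fam : Type
  obj : Type
  pred : Type

mutual

/-- Atomic families `α ::= a | α N`. -/
inductive AFam (L : Names) : Type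
  | con (a : L.fam) : AFam L
  | app (α : AFam L) (N : CObj L) : AFam L

/-- Canonical families `σ ::= α | Πx:σ.τ | 𝓛^P_{N,σ}[ρ]`. -/
inductive Fam (L : Names) : Type
  | atom (α : AFam L) : Fam L
  | pi (σ τ : Fam L) : Fam L
  | lock (P : L.pred) (N : CObj L) (σ ρ : Fam L) : Fam L

/-- Atomic objects `A ::= c | x | A M | 𝓤^P_{N,σ}[A]`. -/
inductive AObj (L : Names) : Type
  | con (c : L.obj) : AObj L
  | var (i : ℕ) : AObj L
  | app (A : AObj L) (M : CObj L) : AObj L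
  | unlock (P : L.pred) (N : CObj L) (σ : Fam L) (A : AObj L) : AObj L

/-- Canonical objects `M ::= A | λx:σ.M | 𝓛^P_{N,σ}[M]`. -/
inductive CObj (L : Names) : Type
  | atom (A : AObj L) : CObj L
  | lam (σ : Fam L) (M : CObj L) : CObj L
  | lock (P : L.pred) (N : CObj L) (σ : Fam L) (M : CObj L) : CObj L

end

/-- Kinds `K ::= Type | Πx:σ.K`. -/
inductive Knd (L : Names) : Type
  | type : Knd L
  | pi (σ : Fam L) (K : Knd L) : Knd L

/-- Simple types.  In `arr ρ₁ ρ₂` the type `ρ₂` is under one binder, since the annotations of the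
locks in it may mention the variable of the product type that was erased. -/
inductive STy (L : Names) : Type
  | con (a : L.fam) : STy L
  | arr (ρ₁ ρ₂ : STy L) : STy L
  | lock (P : L.pred) (N : CObj L) (σ : Fam L) (ρ : STy L) : STy L

/-- Declarations `a : K` and `c : σ` of a signature. -/
inductive Decl (L : Names) : Type
  | fam (a : L.fam) (K : Knd L) : Decl L
  | obj (c : L.obj) (σ : Fam L) : Decl L

abbrev Sig (L : Names) : Type := List (Decl L)

abbrev Ctx (L : Names) : Type := List (Fam L)

variable {L : Names}

/-! ### Renaming, and ordinary substitution of atomic objects for variables -/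

mutual

def AFam.rename (ξ : ℕ → ℕ) : AFam L → AFam L
  | .con a => .con a
  | .app α N => .app (α.rename ξ) (N.rename ξ)

def Fam.rename (ξ : ℕ → ℕ) : Fam L → Fam L
  | .atom α => .atom (α.rename ξ)
  | .pi σ τ => .pi (σ.rename ξ) (τ.rename (liftRen ξ))
  | .lock P N σ ρ => .lock P (N.rename ξ) (σ.rename ξ) (ρ.rename ξ)

def AObj.rename (ξ : ℕ → ℕ) : AObj L → AObj L
  | .con c => .con c
  | .var i => .var (ξ i)
  | .app A M => .app (A.rename ξ) (M.rename ξ)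
  | .unlock P N σ A => .unlock P (N.rename ξ) (σ.rename ξ) (A.rename ξ)

def CObj.rename (ξ : ℕ → ℕ) : CObj L → CObj L
  | .atom A => .atom (A.rename ξ)
  | .lam σ M => .lam (σ.rename ξ) (M.rename (liftRen ξ))
  | .lock P N σ M => .lock P (N.rename ξ) (σ.rename ξ) (M.rename ξ)

end

def STy.rename (ξ : ℕ → ℕ) : STy L → STy L
  | .con a => .con a
  | .arr ρ₁ ρ₂ => .arr (ρ₁.rename ξ) (ρ₂.rename (liftRen ξ))
  | .lock P N σ ρ => .lock P (N.rename ξ) (σ.rename ξ) (ρ.rename ξ)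

/-- Weakening by one variable. -/
abbrev Fam.shift (σ : Fam L) : Fam L := σ.rename Nat.succ

/-- Weakening by one variable. -/
abbrev CObj.shift (M : CObj L) : CObj L := M.rename Nat.succ

/-- Weakening by one variable. -/
abbrev STy.shift (ρ : STy L) : STy L := ρ.rename Nat.succ

/-- Extension of a substitution under one binder. -/
def liftSub (θ : ℕ → AObj L) : ℕ → AObj L
  | 0 => .var 0
  | n + 1 => (θ n).rename Nat.succ

mutual

def AFam.subst (θ : ℕ → AObj L) : AFam L → AFam L
  | .con a => .con a
  | .app α N => .app (α.subst θ) (N.subst θ)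

def Fam.subst (θ : ℕ → AObj L) : Fam L → Fam L
  | .atom α => .atom (α.subst θ)
  | .pi σ τ => .pi (σ.subst θ) (τ.subst (liftSub θ))
  | .lock P N σ ρ => .lock P (N.subst θ) (σ.subst θ) (ρ.subst θ)

def AObj.subst (θ : ℕ → AObj L) : AObj L → AObj L
  | .con c => .con c
  | .var i => θ i
  | .app A M => .app (A.subst θ) (M.subst θ)
  | .unlock P N σ A => .unlock P (N.subst θ) (σ.subst θ) (A.subst θ)

def CObj.subst (θ : ℕ → AObj L) : CObj L → CObj L
  | .atom A => .atom (A.subst θ)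
  | .lam σ M => .lam (σ.subst θ) (M.subst (liftSub θ))
  | .lock P N σ M => .lock P (N.subst θ) (σ.subst θ) (M.subst θ)

end

/-! ### Erasure and hereditary substitution -/

def AFam.erase : AFam L → STy L
  | .con a => .con a
  | .app α _ => α.erase

/-- Erasure `(σ)⁻` of a family to a simple type. -/
def Fam.erase : Fam L → STy L
  | .atom α => α.erase
  | .pi σ τ => .arr σ.erase τ.erase
  | .lock P N σ ρ => .lock P N σ ρ.erase

/- Hereditary substitution of `M₀`, of simple type `ρ₀`, for the variable `k` (which disappears, so that
the variables above `k` are renumbered). -/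
mutual

/-- `α[M₀/k]^f_{ρ₀} = α'` -/
inductive HSubAFam {L : Names} : CObj L → ℕ → STy L → AFam L → AFam L → Prop
  | con {M₀ : CObj L} {k : ℕ} {ρ₀ : STy L} {a : L.fam} :
      HSubAFam M₀ k ρ₀ (.con a) (.con a)
  | app {M₀ : CObj L} {k : ℕ} {ρ₀ : STy L} {α α' : AFam L} {M M' : CObj L} :
      HSubAFam M₀ k ρ₀ α α' → HSubCObj M₀ k ρ₀ M M' →
      HSubAFam M₀ k ρ₀ (.app α M) (.app α' M')

/-- `σ[M₀/k]^F_{ρ₀} = σ'` -/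
inductive HSubFam {L : Names} : CObj L → ℕ → STy L → Fam L → Fam L → Prop
  | atom {M₀ : CObj L} {k : ℕ} {ρ₀ : STy L} {α α' : AFam L} :
      HSubAFam M₀ k ρ₀ α α' → HSubFam M₀ k ρ₀ (.atom α) (.atom α')
  | pi {M₀ : CObj L} {k : ℕ} {ρ₀ : STy L} {σ₁ σ₁' σ₂ σ₂' : Fam L} :
      HSubFam M₀ k ρ₀ σ₁ σ₁' → HSubFam M₀.shift (k + 1) ρ₀.shift σ₂ σ₂' →
      HSubFam M₀ k ρ₀ (.pi σ₁ σ₂) (.pi σ₁' σ₂')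
  | lock {M₀ : CObj L} {k : ℕ} {ρ₀ : STy L} {P : L.pred} {M₁ M₁' : CObj L}
      {σ₁ σ₁' σ₂ σ₂' : Fam L} :
      HSubFam M₀ k ρ₀ σ₁ σ₁' → HSubCObj M₀ k ρ₀ M₁ M₁' → HSubFam M₀ k ρ₀ σ₂ σ₂' →
      HSubFam M₀ k ρ₀ (.lock P M₁ σ₁ σ₂) (.lock P M₁' σ₁' σ₂')

/-- `A[M₀/k]^o_{ρ₀} = A'` -/
inductive HSubAObj {L : Names} : CObj L → ℕ → STy L → AObj L → AObj L → Prop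
  | con {M₀ : CObj L} {k : ℕ} {ρ₀ : STy L} {c : L.obj} :
      HSubAObj M₀ k ρ₀ (.con c) (.con c)
  | var_lt {M₀ : CObj L} {k : ℕ} {ρ₀ : STy L} {i : ℕ} :
      i < k → HSubAObj M₀ k ρ₀ (.var i) (.var i)
  | var_gt {M₀ : CObj L} {k : ℕ} {ρ₀ : STy L} {i : ℕ} :
      k ≤ i → HSubAObj M₀ k ρ₀ (.var (i + 1)) (.var i)
  | app {M₀ : CObj L} {k : ℕ} {ρ₀ : STy L} {A₁ A₁' : AObj L} {M₂ M₂' : CObj L} :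
      HSubAObj M₀ k ρ₀ A₁ A₁' → HSubCObj M₀ k ρ₀ M₂ M₂' →
      HSubAObj M₀ k ρ₀ (.app A₁ M₂) (.app A₁' M₂')
  | unlock {M₀ : CObj L} {k : ℕ} {ρ₀ : STy L} {P : L.pred} {M M' : CObj L} {σ σ' : Fam L}
      {A A' : AObj L} :
      HSubFam M₀ k ρ₀ σ σ' → HSubCObj M₀ k ρ₀ M M' → HSubAObj M₀ k ρ₀ A A' →
      HSubAObj M₀ k ρ₀ (.unlock P M σ A) (.unlock P M' σ' A')

/-- `A[M₀/k]^o_{ρ₀} = M' : ρ`, for `A` with head variable `k` -/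
inductive HSubHead {L : Names} : CObj L → ℕ → STy L → AObj L → CObj L → STy L → Prop
  | var {M₀ : CObj L} {k : ℕ} {ρ₀ : STy L} :
      HSubHead M₀ k ρ₀ (.var k) M₀ ρ₀
  | app {M₀ : CObj L} {k : ℕ} {ρ₀ : STy L} {A₁ : AObj L} {M₂ M₂' M₁' M' : CObj L}
      {σ₂ : Fam L} {ρ₂ ρ : STy L} :
      HSubHead M₀ k ρ₀ A₁ (.lam σ₂ M₁') (.arr ρ₂ ρ.shift) → σ₂.erase = ρ₂ →
      HSubCObj M₀ k ρ₀ M₂ M₂' → HSubCObj M₂' 0 ρ₂ M₁' M' →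
      HSubHead M₀ k ρ₀ (.app A₁ M₂) M' ρ
  | unlock {M₀ : CObj L} {k : ℕ} {ρ₀ : STy L} {P : L.pred} {M M' M₁ : CObj L}
      {σ σ' : Fam L} {A : AObj L} {ρ : STy L} :
      HSubFam M₀ k ρ₀ σ σ' → HSubCObj M₀ k ρ₀ M M' →
      HSubHead M₀ k ρ₀ A (.lock P M' σ' M₁) (.lock P M' σ' ρ) →
      HSubHead M₀ k ρ₀ (.unlock P M σ A) M₁ ρ

/-- `M[M₀/k]^O_{ρ₀} = M'` -/
inductive HSubCObj {L : Names} : CObj L → ℕ → STy L → CObj L → CObj L → Prop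
  | atom {M₀ : CObj L} {k : ℕ} {ρ₀ : STy L} {A A' : AObj L} :
      HSubAObj M₀ k ρ₀ A A' → HSubCObj M₀ k ρ₀ (.atom A) (.atom A')
  | head {M₀ : CObj L} {k : ℕ} {ρ₀ : STy L} {A : AObj L} {M' : CObj L} {ρ : STy L} :
      HSubHead M₀ k ρ₀ A M' ρ → HSubCObj M₀ k ρ₀ (.atom A) M'
  | lam {M₀ : CObj L} {k : ℕ} {ρ₀ : STy L} {σ σ' : Fam L} {M M' : CObj L} :
      HSubFam M₀ k ρ₀ σ σ' → HSubCObj M₀.shift (k + 1) ρ₀.shift M M' →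
      HSubCObj M₀ k ρ₀ (.lam σ M) (.lam σ' M')
  | lock {M₀ : CObj L} {k : ℕ} {ρ₀ : STy L} {P : L.pred} {M₁ M₁' M₂ M₂' : CObj L}
      {σ₁ σ₁' : Fam L} :
      HSubFam M₀ k ρ₀ σ₁ σ₁' → HSubCObj M₀ k ρ₀ M₁ M₁' → HSubCObj M₀ k ρ₀ M₂ M₂' →
      HSubCObj M₀ k ρ₀ (.lock P M₁ σ₁ M₂) (.lock P M₁' σ₁' M₂')

end

/-- `K[M₀/k]^K_{ρ₀} = K'` -/
inductive HSubKnd {L : Names} : CObj L → ℕ → STy L → Knd L → Knd L → Prop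
  | type {M₀ : CObj L} {k : ℕ} {ρ₀ : STy L} : HSubKnd M₀ k ρ₀ .type .type
  | pi {M₀ : CObj L} {k : ℕ} {ρ₀ : STy L} {σ σ' : Fam L} {K K' : Knd L} :
      HSubFam M₀ k ρ₀ σ σ' → HSubKnd M₀.shift (k + 1) ρ₀.shift K K' →
      HSubKnd M₀ k ρ₀ (.pi σ K) (.pi σ' K')

/-! ### The type system -/

/-- A meaning for the lock predicates: predicates `P(Γ ⊢_S N ⇐ σ)` on the data of such a judgement. -/
abbrev Interp (L : Names) : Type := L.pred → Sig L → Ctx L → CObj L → Fam L → Prop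

mutual

/-- `S sig` -/
inductive ValidSig {L : Names} (I : Interp L) : Sig L → Prop
  | empty : ValidSig I []
  | kind {S : Sig L} {a : L.fam} {K : Knd L} :
      ValidSig I S → ValidKnd I S [] K → (∀ K', Decl.fam a K' ∉ S) →
      ValidSig I (Decl.fam a K :: S)
  | type {S : Sig L} {c : L.obj} {σ : Fam L} :
      ValidSig I S → ValidFam I S [] σ → (∀ σ', Decl.obj c σ' ∉ S) →
      ValidSig I (Decl.obj c σ :: S)

/-- `⊢_S Γ` -/
inductive ValidCtx {L : Names} (I : Interp L) : Sig L → Ctx L → Prop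
  | empty {S : Sig L} : ValidSig I S → ValidCtx I S []
  | type {S : Sig L} {Γ : Ctx L} {σ : Fam L} :
      ValidCtx I S Γ → ValidFam I S Γ σ → ValidCtx I S (σ :: Γ)

/-- `Γ ⊢_S K` -/
inductive ValidKnd {L : Names} (I : Interp L) : Sig L → Ctx L → Knd L → Prop
  | type {S : Sig L} {Γ : Ctx L} : ValidCtx I S Γ → ValidKnd I S Γ .type
  | pi {S : Sig L} {Γ : Ctx L} {σ : Fam L} {K : Knd L} :
      ValidKnd I S (σ :: Γ) K → ValidKnd I S Γ (.pi σ K)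

/-- `Γ ⊢_S α ⇒ K` -/
inductive SynthFam {L : Names} (I : Interp L) : Sig L → Ctx L → AFam L → Knd L → Prop
  | con {S : Sig L} {Γ : Ctx L} {a : L.fam} {K : Knd L} :
      ValidCtx I S Γ → Decl.fam a K ∈ S → SynthFam I S Γ (.con a) K
  | app {S : Sig L} {Γ : Ctx L} {α : AFam L} {M : CObj L} {σ : Fam L} {K₁ K : Knd L} :
      SynthFam I S Γ α (.pi σ K₁) → Check I S Γ M σ → HSubKnd M 0 σ.erase K₁ K →
      SynthFam I S Γ (.app α M) K

/-- `Γ ⊢_S σ Type` -/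
inductive ValidFam {L : Names} (I : Interp L) : Sig L → Ctx L → Fam L → Prop
  | atom {S : Sig L} {Γ : Ctx L} {α : AFam L} :
      SynthFam I S Γ α .type → ValidFam I S Γ (.atom α)
  | pi {S : Sig L} {Γ : Ctx L} {σ τ : Fam L} :
      ValidFam I S (σ :: Γ) τ → ValidFam I S Γ (.pi σ τ)
  | lock {S : Sig L} {Γ : Ctx L} {P : L.pred} {N : CObj L} {σ ρ : Fam L} :
      ValidFam I S Γ ρ → Check I S Γ N σ → ValidFam I S Γ (.lock P N σ ρ)
  | nested_unlock {S : Sig L} {Γ : Ctx L} {P : L.pred} {N : CObj L} {σ τ ρ ρ' : Fam L}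
      {A : AObj L} :
      ValidFam I S (τ :: Γ) (.lock P N.shift σ.shift ρ) →
      Synth I S Γ A (.lock P N σ τ) →
      HSubFam (.atom (.unlock P N σ A)) 0 τ.erase ρ ρ' →
      ValidFam I S Γ (.lock P N σ ρ')

/-- `Γ ⊢_S A ⇒ σ` -/
inductive Synth {L : Names} (I : Interp L) : Sig L → Ctx L → AObj L → Fam L → Prop
  | con {S : Sig L} {Γ : Ctx L} {c : L.obj} {σ : Fam L} :
      ValidCtx I S Γ → Decl.obj c σ ∈ S → Synth I S Γ (.con c) σ
  | var {S : Sig L} {Γ : Ctx L} {i : ℕ} {σ : Fam L} :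
      ValidCtx I S Γ → Γ[i]? = some σ → Synth I S Γ (.var i) (σ.rename (· + (i + 1)))
  | app {S : Sig L} {Γ : Ctx L} {A : AObj L} {M : CObj L} {σ τ₁ τ : Fam L} :
      Synth I S Γ A (.pi σ τ₁) → Check I S Γ M σ → HSubFam M 0 σ.erase τ₁ τ →
      Synth I S Γ (.app A M) τ
  | unlock {S : Sig L} {Γ : Ctx L} {P : L.pred} {N : CObj L} {σ ρ : Fam L} {A : AObj L} :
      Synth I S Γ A (.lock P N σ ρ) → Check I S Γ N σ → I P S Γ N σ →
      Synth I S Γ (.unlock P N σ A) ρ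

/-- `Γ ⊢_S M ⇐ σ` -/
inductive Check {L : Names} (I : Interp L) : Sig L → Ctx L → CObj L → Fam L → Prop
  | atom {S : Sig L} {Γ : Ctx L} {A : AObj L} {α : AFam L} :
      Synth I S Γ A (.atom α) → Check I S Γ (.atom A) (.atom α)
  | lam {S : Sig L} {Γ : Ctx L} {σ τ : Fam L} {M : CObj L} :
      Check I S (σ :: Γ) M τ → Check I S Γ (.lam σ M) (.pi σ τ)
  | lock {S : Sig L} {Γ : Ctx L} {P : L.pred} {N M : CObj L} {σ ρ : Fam L} :
      Check I S Γ M ρ → Check I S Γ N σ → Check I S Γ (.lock P N σ M) (.lock P N σ ρ)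
  | nested_unlock {S : Sig L} {Γ : Ctx L} {P : L.pred} {N M M' : CObj L} {σ τ ρ ρ' : Fam L}
      {A : AObj L} :
      Check I S (τ :: Γ) (.lock P N.shift σ.shift M) (.lock P N.shift σ.shift ρ) →
      Synth I S Γ A (.lock P N σ τ) →
      HSubFam (.atom (.unlock P N σ A)) 0 τ.erase ρ ρ' →
      HSubCObj (.atom (.unlock P N σ A)) 0 τ.erase M M' →
      Check I S Γ (.lock P N σ M') (.lock P N σ ρ')

end

/-- The non-dependent product `σ → τ`. -/
abbrev Fam.arrow (σ τ : Fam L) : Fam L := .pi σ τ.shift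

end CLLFP

/-! ## Fitch-Prawitz set theory -/

namespace FPST

mutual

/-- Individual terms `T ::= x | λx.A`; the set `{x | A}` is written `λx.A`. -/
inductive Tm : Type
  | var (i : ℕ) : Tm
  | set (A : Fm) : Tm

/-- Formulas `A ::= p | T ∈ T | A ⊃ A`, where `p` ranges over countably many propositional letters. -/
inductive Fm : Type
  | letter (p : ℕ) : Fm
  | mem (t s : Tm) : Fm
  | imp (A B : Fm) : Fm

end

mutual

def Tm.rename (ξ : ℕ → ℕ) : Tm → Tm
  | .var i => .var (ξ i)
  | .set A => .set (A.rename (liftRen ξ))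

def Fm.rename (ξ : ℕ → ℕ) : Fm → Fm
  | .letter p => .letter p
  | .mem t s => .mem (t.rename ξ) (s.rename ξ)
  | .imp A B => .imp (A.rename ξ) (B.rename ξ)

end

/-- Extension of a substitution under one binder. -/
def liftSub (θ : ℕ → Tm) : ℕ → Tm
  | 0 => .var 0
  | n + 1 => (θ n).rename Nat.succ

mutual

def Tm.subst (θ : ℕ → Tm) : Tm → Tm
  | .var i => θ i
  | .set A => .set (A.subst (liftSub θ))

def Fm.subst (θ : ℕ → Tm) : Fm → Fm
  | .letter p => .letter p
  | .mem t s => .mem (t.subst θ) (s.subst θ)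
  | .imp A B => .imp (A.subst θ) (B.subst θ)

end

/-- `A[T/x]`, where `x` is the variable `0` of `A`. -/
def Fm.inst (A : Fm) (t : Tm) : Fm :=
  A.subst fun
    | 0 => t
    | n + 1 => .var n

mutual

/-- All free individual variables are smaller than `k`. -/
def Tm.Below (k : ℕ) : Tm → Prop
  | .var i => i < k
  | .set A => A.Below (k + 1)

/-- All free individual variables are smaller than `k`. -/
def Fm.Below (k : ℕ) : Fm → Prop
  | .letter _ => True
  | .mem t s => t.Below k ∧ s.Below k
  | .imp A B => A.Below k ∧ B.Below k

end

/-- The formula has no free individual variables. -/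
def Fm.Closed (A : Fm) : Prop := A.Below 0

mutual

/-- The propositional letters that occur in an individual term. -/
def Tm.letters : Tm → Set ℕ
  | .var _ => ∅
  | .set A => A.letters

/-- The propositional letters that occur in a formula. -/
def Fm.letters : Fm → Set ℕ
  | .letter p => {p}
  | .mem t s => t.letters ∪ s.letters
  | .imp A B => A.letters ∪ B.letters

end

/-- Proof trees: the tree of the inferences of a natural deduction.  `hyp i` is a use of assumption
number `i`, and `impI` discharges assumption number `0` of its premise.  In `impE p q` the tree `p` is
that of the minor premise and `q` that of the major premise. -/
inductive Prf : Type
  | hyp (i : ℕ) : Prf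
  | impI (p : Prf) : Prf
  | impE (p q : Prf) : Prf
  | lamI (p : Prf) : Prf
  | lamE (p : Prf) : Prf

/-- `Quasi Γ p A`: the tree `p` is that of a quasi-deduction of `A` from the assumptions `Γ`. -/
inductive Quasi : List Fm → Prf → Fm → Prop
  | hyp {Γ : List Fm} {i : ℕ} {A : Fm} : Γ[i]? = some A → Quasi Γ (.hyp i) A
  | impI {Γ : List Fm} {p : Prf} {A B : Fm} :
      Quasi (A :: Γ) p B → Quasi Γ (.impI p) (.imp A B)
  | impE {Γ : List Fm} {p q : Prf} {A B : Fm} :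
      Quasi Γ p A → Quasi Γ q (.imp A B) → Quasi Γ (.impE p q) B
  | lamI {Γ : List Fm} {p : Prf} {A : Fm} {t : Tm} :
      Quasi Γ p (A.inst t) → Quasi Γ (.lamI p) (.mem t (.set A))
  | lamE {Γ : List Fm} {p : Prf} {A : Fm} {t : Tm} :
      Quasi Γ p (.mem t (.set A)) → Quasi Γ (.lamE p) (A.inst t)

/-! ### Normalization of proof trees -/

def Prf.rename (ξ : ℕ → ℕ) : Prf → Prf
  | .hyp i => .hyp (ξ i)
  | .impI p => .impI (p.rename (liftRen ξ))
  | .impE p q => .impE (p.rename ξ) (q.rename ξ)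
  | .lamI p => .lamI (p.rename ξ)
  | .lamE p => .lamE (p.rename ξ)

/-- Extension under one more assumption of a replacement of assumptions by proof trees. -/
def Prf.lift (θ : ℕ → Prf) : ℕ → Prf
  | 0 => .hyp 0
  | n + 1 => (θ n).rename Nat.succ

def Prf.subst (θ : ℕ → Prf) : Prf → Prf
  | .hyp i => θ i
  | .impI p => .impI (p.subst (Prf.lift θ))
  | .impE p q => .impE (p.subst θ) (q.subst θ)
  | .lamI p => .lamI (p.subst θ)
  | .lamE p => .lamE (p.subst θ)

/-- `q` with the tree `p` put in place of all uses of assumption number `0`. -/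
def Prf.plug (q p : Prf) : Prf :=
  q.subst fun
    | 0 => p
    | n + 1 => .hyp n

/-- One step of normalization: removal, anywhere in the tree, of an elimination whose major premise is
the conclusion of an introduction. -/
inductive Prf.Step : Prf → Prf → Prop
  | imp {p q : Prf} : Prf.Step (.impE p (.impI q)) (q.plug p)
  | lam {p : Prf} : Prf.Step (.lamE (.lamI p)) p
  | impI {p p' : Prf} : Prf.Step p p' → Prf.Step (.impI p) (.impI p')
  | impE_left {p p' q : Prf} : Prf.Step p p' → Prf.Step (.impE p q) (.impE p' q)
  | impE_right {p q q' : Prf} : Prf.Step q q' → Prf.Step (.impE p q) (.impE p q')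
  | lamI {p p' : Prf} : Prf.Step p p' → Prf.Step (.lamI p) (.lamI p')
  | lamE {p p' : Prf} : Prf.Step p p' → Prf.Step (.lamE p) (.lamE p')

/-- No elimination in the tree has a major premise that is the conclusion of an introduction. -/
def Prf.Normal (p : Prf) : Prop := ∀ q, ¬ Prf.Step p q

def Prf.Normalizable (p : Prf) : Prop := ∃ q, Relation.ReflTransGen Prf.Step p q ∧ q.Normal

/-- `Γ ⊢ A` in Fitch-Prawitz set theory: there is a legal deduction, that is, a normalizable
quasi-deduction, of `A` from `Γ`. -/
def Provable (Γ : List Fm) (A : Fm) : Prop := ∃ p, Quasi Γ p A ∧ p.Normalizable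

/-! ### The signature -/

open CLLFP

inductive FamName : Type
  | o | ind | T | V

inductive ObjName : Type
  | lam | eps | imp | delta | lamIntro | lamElim | impIntro | impElim

inductive PredName : Type
  | fitch

abbrev names : Names := ⟨FamName, ObjName, PredName⟩

abbrev o : Fam names := .atom (.con FamName.o)

/-- The type `ι` of individuals. -/
abbrev ind : Fam names := .atom (.con FamName.ind)

abbrev T (A : CObj names) : Fam names := .atom (.app (.con FamName.T) A)

abbrev V (A : CObj names) : Fam names := .atom (.app (.con FamName.V) A)

abbrev vr (i : ℕ) : CObj names := .atom (.var i)

/-- `lam A`, for `A : ι → o` -/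
abbrev lamO (A : CObj names) : CObj names := .atom (.app (.con ObjName.lam) A)

/-- `ε t s` -/
abbrev epsO (t s : CObj names) : CObj names := .atom (.app (.app (.con ObjName.eps) t) s)

/-- `A ⊃ B` -/
abbrev impO (A B : CObj names) : CObj names := .atom (.app (.app (.con ObjName.imp) A) B)

/-- `σ × τ`, that is `(σ → τ → o) → o` -/
abbrev prodF (σ τ : Fam names) : Fam names := (σ.arrow (τ.arrow o)).arrow o

/-- `⟨x, y⟩ : σ × τ`, that is `λu:(σ → τ → o). u x y` -/
abbrev pairO (σ τ : Fam names) (x y : CObj names) : CObj names :=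
  .lam (σ.arrow (τ.arrow o)) (.atom (.app (.app (.var 0) x.shift) y.shift))

/-- `𝓛^Fitch_{⟨x,y⟩, T(A)×T(A⊃B)}[T(B)]` -/
abbrev fitchLock (A B x y : CObj names) : Fam names :=
  .lock PredName.fitch (pairO (T A) (T (impO A B)) x y) (prodF (T A) (T (impO A B))) (T B)

/-- The signature of Fitch-Prawitz set theory.  A variable `A : ι → o` in argument position is written
in its long form `λz:ι. A z`, as canonical syntax demands. -/
def sig : Sig names := List.reverse
  [ .fam FamName.o .type,
    .fam FamName.ind .type,
    .fam FamName.T (.pi o .type),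
    .fam FamName.V (.pi o .type),
    .obj ObjName.lam ((ind.arrow o).arrow ind),
    .obj ObjName.eps (ind.arrow (ind.arrow o)),
    .obj ObjName.imp (o.arrow (o.arrow o)),
    -- `ΠA:o. V(A) → T(A)`
    .obj ObjName.delta (.pi o ((V (vr 0)).arrow (T (vr 0)))),
    -- `ΠA:ι→o. Πx:ι. T(A x) → T(ε x (lam A))`
    .obj ObjName.lamIntro (.pi (ind.arrow o) (.pi ind
      ((T (.atom (.app (.var 1) (vr 0)))).arrow
        (T (epsO (vr 0) (lamO (.lam ind (.atom (.app (.var 2) (vr 0)))))))))),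
    -- `ΠA:ι→o. Πx:ι. T(ε x (lam A)) → T(A x)`
    .obj ObjName.lamElim (.pi (ind.arrow o) (.pi ind
      ((T (epsO (vr 0) (lamO (.lam ind (.atom (.app (.var 2) (vr 0))))))).arrow
        (T (.atom (.app (.var 1) (vr 0))))))),
    -- `ΠA,B:o. (V(A) → T(B)) → T(A ⊃ B)`
    .obj ObjName.impIntro (.pi o (.pi o
      (((V (vr 1)).arrow (T (vr 0))).arrow (T (impO (vr 1) (vr 0)))))),
    -- `ΠA,B:o. Πx:T(A). Πy:T(A ⊃ B). 𝓛^Fitch_{⟨x,y⟩, T(A)×T(A⊃B)}[T(B)]`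
    .obj ObjName.impElim (.pi o (.pi o (.pi (T (vr 1)) (.pi (T (impO (vr 2) (vr 1)))
      (fitchLock (vr 3) (vr 2) (vr 1) (vr 0)))))) ]

/-! ### Proof trees of objects, and the predicate in the lock -/

/-- `ProofOf M p`: the object `M` is built from the constants for the inference rules, with `p` as its
tree of inferences.  The assumptions of the tree are the variables of `M` that are coerced by `δ`, under
the same numbers as in `M`. -/
inductive ProofOf : CObj names → Prf → Prop
  | delta {A : CObj names} {i : ℕ} :
      ProofOf (.atom (.app (.app (.con ObjName.delta) A) (vr i))) (.hyp i)
  | impIntro {A B : CObj names} {σ : Fam names} {M : CObj names} {p : Prf} :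
      ProofOf M p →
      ProofOf (.atom (.app (.app (.app (.con ObjName.impIntro) A) B) (.lam σ M))) (.impI p)
  | impElim {A B N : CObj names} {σ : Fam names} {x y : CObj names} {p q : Prf} :
      ProofOf x p → ProofOf y q →
      ProofOf (.atom (.unlock PredName.fitch N σ
        (.app (.app (.app (.app (.con ObjName.impElim) A) B) x) y))) (.impE p q)
  | lamIntro {A t M : CObj names} {p : Prf} :
      ProofOf M p →
      ProofOf (.atom (.app (.app (.app (.con ObjName.lamIntro) A) t) M)) (.lamI p)
  | lamElim {A t M : CObj names} {p : Prf} :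
      ProofOf M p →
      ProofOf (.atom (.app (.app (.app (.con ObjName.lamElim) A) t) M)) (.lamE p)

/-- The object represents a normalizable proof. -/
def NormalizableObj (M : CObj names) : Prop := ∃ p, ProofOf M p ∧ p.Normalizable

/-- The predicate `Fitch(Γ ⊢_S ⟨x,y⟩ ⇐ T(A)×T(A⊃B))`: the objects `x` and `y` have skeletons `X` and `Y`,
instantiated by `θ`, whose holes, listed in `Δ`, have type `o` or a type `V(E)` (the latter kind can
only occur guarded by a `δ`), and the proof that combines the skeletons is normalizable.  The
skeletons are terms over the signature; the locks in them are not checked again. -/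
def fitch : Interp names := fun _ S _ N σ =>
  ∃ A B x y : CObj names,
    N = pairO (T A) (T (impO A B)) x y ∧ σ = prodF (T A) (T (impO A B)) ∧
    ∃ (Δ : Ctx names) (C D X Y : CObj names) (θ : ℕ → AObj names) (p q : Prf),
      (∀ τ ∈ Δ, τ = o ∨ ∃ E, τ = V E) ∧
      Check (fun _ _ _ _ _ => True) S Δ X (T C) ∧
      Check (fun _ _ _ _ _ => True) S Δ Y (T (impO C D)) ∧
      X.subst θ = x ∧ Y.subst θ = y ∧
      ProofOf X p ∧ ProofOf Y q ∧ (Prf.impE p q).Normalizable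

/-! ### The encoding of formulas and assumptions -/

mutual

/-- Encoding of individual terms; the letter `p` is represented by the variable `e p`. -/
def Tm.enc (e : ℕ → ℕ) : Tm → CObj names
  | .var i => vr i
  | .set A => lamO (.lam ind (A.enc (fun p => e p + 1)))

/-- Encoding of formulas; the letter `p` is represented by the variable `e p`. -/
def Fm.enc (e : ℕ → ℕ) : Fm → CObj names
  | .letter p => vr (e p)
  | .mem t s => epsO (t.enc e) (s.enc e)
  | .imp A B => impO (A.enc e) (B.enc e)

end

/-- Encoding of `B` in the scope of the letters `As`, followed by `m` further variables. -/
def Fm.encIn (As : List ℕ) (m : ℕ) (B : Fm) : CObj names := B.enc (fun p => m + As.idxOf p)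

/-- The context `A₁:o, …, Aₙ:o, x₁:V(B₁), …, xₘ:V(Bₘ)` -/
def encCtx (As : List ℕ) : List Fm → Ctx names
  | [] => As.map (fun _ => o)
  | B :: Bs => V (B.encIn As Bs.length) :: encCtx As Bs

end FPST

theorem liftRen_id : liftRen id = id := by
  funext i; cases i <;> rfl

theorem liftRen_comp (ξ ζ : ℕ → ℕ) : liftRen ξ ∘ liftRen ζ = liftRen (ξ ∘ ζ) := by
  funext i; cases i <;> rfl

/-- The renaming that leaves out the variable `k`. -/
def skipRen (k : ℕ) (i : ℕ) : ℕ := if i < k then i else i + 1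

theorem liftRen_skipRen (k : ℕ) : liftRen (skipRen k) = skipRen (k + 1) := by
  funext i
  cases i with
  | zero => simp [liftRen, skipRen]
  | succ i => simp only [liftRen, skipRen]; split_ifs <;> omega

theorem skipRen_zero : skipRen 0 = Nat.succ := by
  funext i; simp [skipRen]

namespace CLLFP

variable {L : Names}

/-! ### Renaming -/

mutual

theorem AFam.rename_rename (ξ ζ : ℕ → ℕ) :
    ∀ α : AFam L, (α.rename ζ).rename ξ = α.rename (ξ ∘ ζ)
  | .con a => rfl
  | .app α N => by simp [AFam.rename, AFam.rename_rename ξ ζ α, CObj.rename_rename ξ ζ N]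

theorem Fam.rename_rename (ξ ζ : ℕ → ℕ) :
    ∀ σ : Fam L, (σ.rename ζ).rename ξ = σ.rename (ξ ∘ ζ)
  | .atom α => by simp [Fam.rename, AFam.rename_rename ξ ζ α]
  | .pi σ τ => by
      simp [Fam.rename, Fam.rename_rename ξ ζ σ, Fam.rename_rename _ _ τ, liftRen_comp]
  | .lock P N σ ρ => by
      simp [Fam.rename, Fam.rename_rename ξ ζ σ, Fam.rename_rename ξ ζ ρ,
        CObj.rename_rename ξ ζ N]

theorem AObj.rename_rename (ξ ζ : ℕ → ℕ) :
    ∀ A : AObj L, (A.rename ζ).rename ξ = A.rename (ξ ∘ ζ)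
  | .con c => rfl
  | .var i => rfl
  | .app A M => by simp [AObj.rename, AObj.rename_rename ξ ζ A, CObj.rename_rename ξ ζ M]
  | .unlock P N σ A => by
      simp [AObj.rename, AObj.rename_rename ξ ζ A, CObj.rename_rename ξ ζ N,
        Fam.rename_rename ξ ζ σ]

theorem CObj.rename_rename (ξ ζ : ℕ → ℕ) :
    ∀ M : CObj L, (M.rename ζ).rename ξ = M.rename (ξ ∘ ζ)
  | .atom A => by simp [CObj.rename, AObj.rename_rename ξ ζ A]
  | .lam σ M => by
      simp [CObj.rename, Fam.rename_rename ξ ζ σ, CObj.rename_rename _ _ M, liftRen_comp]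
  | .lock P N σ M => by
      simp [CObj.rename, Fam.rename_rename ξ ζ σ, CObj.rename_rename ξ ζ N,
        CObj.rename_rename ξ ζ M]

end

mutual

theorem AFam.rename_id : ∀ α : AFam L, α.rename id = α
  | .con a => rfl
  | .app α N => by simp [AFam.rename, AFam.rename_id α, CObj.rename_id N]

theorem Fam.rename_id : ∀ σ : Fam L, σ.rename id = σ
  | .atom α => by simp [Fam.rename, AFam.rename_id α]
  | .pi σ τ => by simp [Fam.rename, Fam.rename_id σ, Fam.rename_id τ, liftRen_id]
  | .lock P N σ ρ => by
      simp [Fam.rename, Fam.rename_id σ, Fam.rename_id ρ, CObj.rename_id N]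

theorem AObj.rename_id : ∀ A : AObj L, A.rename id = A
  | .con c => rfl
  | .var i => rfl
  | .app A M => by simp [AObj.rename, AObj.rename_id A, CObj.rename_id M]
  | .unlock P N σ A => by
      simp [AObj.rename, AObj.rename_id A, CObj.rename_id N, Fam.rename_id σ]

theorem CObj.rename_id : ∀ M : CObj L, M.rename id = M
  | .atom A => by simp [CObj.rename, AObj.rename_id A]
  | .lam σ M => by simp [CObj.rename, Fam.rename_id σ, CObj.rename_id M, liftRen_id]
  | .lock P N σ M => by
      simp [CObj.rename, Fam.rename_id σ, CObj.rename_id N, CObj.rename_id M]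

end

theorem liftSub_var (ξ : ℕ → ℕ) :
    liftSub (fun i => (.var (ξ i) : AObj L)) = fun i => .var (liftRen ξ i) := by
  funext i; cases i <;> rfl

mutual

theorem AFam.subst_var (ξ : ℕ → ℕ) :
    ∀ α : AFam L, α.subst (fun i => .var (ξ i)) = α.rename ξ
  | .con a => rfl
  | .app α N => by
      simp [AFam.rename, AFam.subst, AFam.subst_var ξ α, CObj.subst_var ξ N]

theorem Fam.subst_var (ξ : ℕ → ℕ) :
    ∀ σ : Fam L, σ.subst (fun i => .var (ξ i)) = σ.rename ξ
  | .atom α => by simp [Fam.rename, Fam.subst, AFam.subst_var ξ α]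
  | .pi σ τ => by
      simp [Fam.rename, Fam.subst, liftSub_var, Fam.subst_var ξ σ, Fam.subst_var _ τ]
  | .lock P N σ ρ => by
      simp [Fam.rename, Fam.subst, Fam.subst_var ξ σ, Fam.subst_var ξ ρ, CObj.subst_var ξ N]

theorem AObj.subst_var (ξ : ℕ → ℕ) :
    ∀ A : AObj L, A.subst (fun i => .var (ξ i)) = A.rename ξ
  | .con c => rfl
  | .var i => rfl
  | .app A M => by
      simp [AObj.rename, AObj.subst, AObj.subst_var ξ A, CObj.subst_var ξ M]
  | .unlock P N σ A => by
      simp [AObj.rename, AObj.subst, AObj.subst_var ξ A, CObj.subst_var ξ N,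
        Fam.subst_var ξ σ]

theorem CObj.subst_var (ξ : ℕ → ℕ) :
    ∀ M : CObj L, M.subst (fun i => .var (ξ i)) = M.rename ξ
  | .atom A => by simp [CObj.rename, CObj.subst, AObj.subst_var ξ A]
  | .lam σ M => by
      simp [CObj.rename, CObj.subst, liftSub_var, Fam.subst_var ξ σ, CObj.subst_var _ M]
  | .lock P N σ M => by
      simp [CObj.rename, CObj.subst, Fam.subst_var ξ σ, CObj.subst_var ξ N,
        CObj.subst_var ξ M]

end

/-! ### Hereditary substitution: inversion -/

section Inversion

variable {M₀ : CObj L} {k : ℕ} {ρ₀ : STy L}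

theorem hsubAFam_con {a : L.fam} {α' : AFam L} :
    HSubAFam M₀ k ρ₀ (.con a) α' ↔ α' = .con a :=
  ⟨by rintro ⟨⟩; rfl, by rintro rfl; exact .con⟩

theorem hsubAFam_app {α α' : AFam L} {N : CObj L} :
    HSubAFam M₀ k ρ₀ (.app α N) α' ↔
      ∃ α₁ N₁, HSubAFam M₀ k ρ₀ α α₁ ∧ HSubCObj M₀ k ρ₀ N N₁ ∧ α' = .app α₁ N₁ :=
  ⟨by rintro (_ | ⟨h₁, h₂⟩); exact ⟨_, _, h₁, h₂, rfl⟩,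
    by rintro ⟨_, _, h₁, h₂, rfl⟩; exact .app h₁ h₂⟩

theorem hsubFam_atom {α : AFam L} {σ' : Fam L} :
    HSubFam M₀ k ρ₀ (.atom α) σ' ↔ ∃ α', HSubAFam M₀ k ρ₀ α α' ∧ σ' = .atom α' :=
  ⟨by rintro ⟨h⟩; exact ⟨_, h, rfl⟩, by rintro ⟨_, h, rfl⟩; exact .atom h⟩

theorem hsubFam_pi {σ τ σ' : Fam L} :
    HSubFam M₀ k ρ₀ (.pi σ τ) σ' ↔
      ∃ σ₁ τ₁, HSubFam M₀ k ρ₀ σ σ₁ ∧ HSubFam M₀.shift (k + 1) ρ₀.shift τ τ₁ ∧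
        σ' = .pi σ₁ τ₁ :=
  ⟨by rintro (_ | ⟨h₁, h₂⟩); exact ⟨_, _, h₁, h₂, rfl⟩,
    by rintro ⟨_, _, h₁, h₂, rfl⟩; exact .pi h₁ h₂⟩

theorem hsubFam_lock {P : L.pred} {N : CObj L} {σ ρ σ' : Fam L} :
    HSubFam M₀ k ρ₀ (.lock P N σ ρ) σ' ↔
      ∃ σ₁ N₁ ρ₁, HSubFam M₀ k ρ₀ σ σ₁ ∧ HSubCObj M₀ k ρ₀ N N₁ ∧ HSubFam M₀ k ρ₀ ρ ρ₁ ∧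
        σ' = .lock P N₁ σ₁ ρ₁ :=
  ⟨by rintro (_ | _ | ⟨h₁, h₂, h₃⟩); exact ⟨_, _, _, h₁, h₂, h₃, rfl⟩,
    by rintro ⟨_, _, _, h₁, h₂, h₃, rfl⟩; exact .lock h₁ h₂ h₃⟩

theorem hsubAObj_con {c : L.obj} {A' : AObj L} :
    HSubAObj M₀ k ρ₀ (.con c) A' ↔ A' = .con c :=
  ⟨by rintro ⟨⟩; rfl, by rintro rfl; exact .con⟩

theorem hsubAObj_var {i : ℕ} {A' : AObj L} :
    HSubAObj M₀ k ρ₀ (.var i) A' ↔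
      i < k ∧ A' = .var i ∨ k < i ∧ A' = .var (i - 1) := by
  constructor
  · intro h
    cases h with
    | var_lt h => exact .inl ⟨h, rfl⟩
    | var_gt h => exact .inr ⟨by omega, rfl⟩
  · rintro (⟨h, rfl⟩ | ⟨h, rfl⟩)
    · exact .var_lt h
    · obtain ⟨j, rfl⟩ : ∃ j, i = j + 1 := ⟨i - 1, by omega⟩
      exact .var_gt (by omega)

theorem hsubAObj_app {A A' : AObj L} {M : CObj L} :
    HSubAObj M₀ k ρ₀ (.app A M) A' ↔
      ∃ A₁ M₁, HSubAObj M₀ k ρ₀ A A₁ ∧ HSubCObj M₀ k ρ₀ M M₁ ∧ A' = .app A₁ M₁ :=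
  ⟨by intro h; cases h with | app h₁ h₂ => exact ⟨_, _, h₁, h₂, rfl⟩,
    by rintro ⟨_, _, h₁, h₂, rfl⟩; exact .app h₁ h₂⟩

theorem hsubAObj_unlock {P : L.pred} {N : CObj L} {σ : Fam L} {A A' : AObj L} :
    HSubAObj M₀ k ρ₀ (.unlock P N σ A) A' ↔
      ∃ σ₁ N₁ A₁, HSubFam M₀ k ρ₀ σ σ₁ ∧ HSubCObj M₀ k ρ₀ N N₁ ∧ HSubAObj M₀ k ρ₀ A A₁ ∧
        A' = .unlock P N₁ σ₁ A₁ :=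
  ⟨by intro h; cases h with | unlock h₁ h₂ h₃ => exact ⟨_, _, _, h₁, h₂, h₃, rfl⟩,
    by rintro ⟨_, _, _, h₁, h₂, h₃, rfl⟩; exact .unlock h₁ h₂ h₃⟩

theorem hsubHead_con {c : L.obj} {M' : CObj L} {ρ : STy L} :
    ¬ HSubHead M₀ k ρ₀ (.con c) M' ρ := by rintro ⟨⟩

theorem hsubHead_var {i : ℕ} {M' : CObj L} {ρ : STy L} :
    HSubHead M₀ k ρ₀ (.var i) M' ρ ↔ i = k ∧ M' = M₀ ∧ ρ = ρ₀ :=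
  ⟨by rintro ⟨⟩; exact ⟨rfl, rfl, rfl⟩, by rintro ⟨rfl, rfl, rfl⟩; exact .var⟩

theorem hsubHead_app {A : AObj L} {M M' : CObj L} {ρ : STy L} :
    HSubHead M₀ k ρ₀ (.app A M) M' ρ ↔
      ∃ σ N M₁, HSubHead M₀ k ρ₀ A (.lam σ N) (.arr σ.erase ρ.shift) ∧
        HSubCObj M₀ k ρ₀ M M₁ ∧ HSubCObj M₁ 0 σ.erase N M' :=
  ⟨by
    intro h
    cases h with | app h₁ h₂ h₃ h₄ => subst h₂; exact ⟨_, _, _, h₁, h₃, h₄⟩,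
    by rintro ⟨_, _, _, h₁, h₂, h₃⟩; exact .app h₁ rfl h₂ h₃⟩

theorem hsubCObj_atom {A : AObj L} {M' : CObj L} :
    HSubCObj M₀ k ρ₀ (.atom A) M' ↔
      (∃ A', HSubAObj M₀ k ρ₀ A A' ∧ M' = .atom A') ∨ ∃ ρ, HSubHead M₀ k ρ₀ A M' ρ :=
  ⟨by
    intro h
    cases h with
    | atom h => exact .inl ⟨_, h, rfl⟩
    | head h => exact .inr ⟨_, h⟩,
    by rintro (⟨_, h, rfl⟩ | ⟨_, h⟩); exacts [.atom h, .head h]⟩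

theorem hsubCObj_lam {σ : Fam L} {M M' : CObj L} :
    HSubCObj M₀ k ρ₀ (.lam σ M) M' ↔
      ∃ σ₁ M₁, HSubFam M₀ k ρ₀ σ σ₁ ∧ HSubCObj M₀.shift (k + 1) ρ₀.shift M M₁ ∧
        M' = .lam σ₁ M₁ :=
  ⟨by intro h; cases h with | lam h₁ h₂ => exact ⟨_, _, h₁, h₂, rfl⟩,
    by rintro ⟨_, _, h₁, h₂, rfl⟩; exact .lam h₁ h₂⟩

theorem hsubCObj_lock {P : L.pred} {N : CObj L} {σ : Fam L} {M M' : CObj L} :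
    HSubCObj M₀ k ρ₀ (.lock P N σ M) M' ↔
      ∃ σ₁ N₁ M₁, HSubFam M₀ k ρ₀ σ σ₁ ∧ HSubCObj M₀ k ρ₀ N N₁ ∧ HSubCObj M₀ k ρ₀ M M₁ ∧
        M' = .lock P N₁ σ₁ M₁ :=
  ⟨by intro h; cases h with | lock h₁ h₂ h₃ => exact ⟨_, _, _, h₁, h₂, h₃, rfl⟩,
    by rintro ⟨_, _, _, h₁, h₂, h₃, rfl⟩; exact .lock h₁ h₂ h₃⟩

end Inversion

/-! ### Hereditary substitution for a variable that does not occur -/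

theorem not_hsubHead_skipRen {M₀ : CObj L} {k : ℕ} {ρ₀ : STy L} :
    ∀ (A : AObj L) {M' : CObj L} {ρ : STy L},
      ¬ HSubHead M₀ k ρ₀ (A.rename (skipRen k)) M' ρ
  | .con c, _, _, h => hsubHead_con h
  | .var i, _, _, h => by
      have := (hsubHead_var.1 h).1
      unfold skipRen at this
      split_ifs at this <;> omega
  | .app A M, _, _, h => by
      obtain ⟨_, _, _, h, -⟩ := hsubHead_app.1 h
      exact not_hsubHead_skipRen A h
  | .unlock P N σ A, _, _, h => by
      cases h with | unlock _ _ h => exact not_hsubHead_skipRen A h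

mutual

theorem hsubAFam_skipRen {M₀ : CObj L} {k : ℕ} {ρ₀ : STy L} :
    ∀ (α : AFam L) {α' : AFam L}, HSubAFam M₀ k ρ₀ (α.rename (skipRen k)) α' ↔ α' = α
  | .con a, _ => hsubAFam_con
  | .app α N, _ => by
      simp [AFam.rename, hsubAFam_app, hsubAFam_skipRen α, hsubCObj_skipRen N]

theorem hsubFam_skipRen {M₀ : CObj L} {k : ℕ} {ρ₀ : STy L} :
    ∀ (σ : Fam L) {σ' : Fam L}, HSubFam M₀ k ρ₀ (σ.rename (skipRen k)) σ' ↔ σ' = σ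
  | .atom α, _ => by simp [Fam.rename, hsubFam_atom, hsubAFam_skipRen α]
  | .pi σ τ, _ => by
      simp [Fam.rename, hsubFam_pi, liftRen_skipRen, hsubFam_skipRen σ, hsubFam_skipRen τ]
  | .lock P N σ ρ, _ => by
      simp [Fam.rename, hsubFam_lock, hsubFam_skipRen σ, hsubCObj_skipRen N,
        hsubFam_skipRen ρ]

theorem hsubAObj_skipRen {M₀ : CObj L} {k : ℕ} {ρ₀ : STy L} :
    ∀ (A : AObj L) {A' : AObj L}, HSubAObj M₀ k ρ₀ (A.rename (skipRen k)) A' ↔ A' = A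
  | .con c, _ => hsubAObj_con
  | .var i, A' => by
      simp only [AObj.rename, hsubAObj_var, skipRen]
      split_ifs with h
      · simp [h, not_lt.2 h.le]
      · simp [show ¬ i + 1 < k by omega, show k < i + 1 by omega]
  | .app A M, _ => by
      simp [AObj.rename, hsubAObj_app, hsubAObj_skipRen A, hsubCObj_skipRen M]
  | .unlock P N σ A, _ => by
      simp [AObj.rename, hsubAObj_unlock, hsubAObj_skipRen A, hsubCObj_skipRen N,
        hsubFam_skipRen σ]

theorem hsubCObj_skipRen {M₀ : CObj L} {k : ℕ} {ρ₀ : STy L} :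
    ∀ (M : CObj L) {M' : CObj L}, HSubCObj M₀ k ρ₀ (M.rename (skipRen k)) M' ↔ M' = M
  | .atom A, _ => by
      simp [CObj.rename, hsubCObj_atom, hsubAObj_skipRen A, not_hsubHead_skipRen A]
  | .lam σ M, _ => by
      simp [CObj.rename, hsubCObj_lam, liftRen_skipRen, hsubFam_skipRen σ,
        hsubCObj_skipRen M]
  | .lock P N σ M, _ => by
      simp [CObj.rename, hsubCObj_lock, hsubFam_skipRen σ, hsubCObj_skipRen N,
        hsubCObj_skipRen M]

end

/-- Weakening by `n` variables. -/
def CObj.up (n : ℕ) (M : CObj L) : CObj L := M.rename (· + n)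

theorem CObj.up_zero (M : CObj L) : M.up 0 = M := M.rename_id

theorem CObj.shift_eq_up (M : CObj L) : M.shift = M.up 1 := rfl

theorem CObj.rename_up_of_add {ξ : ℕ → ℕ} {n m : ℕ} (h : ∀ i, ξ (i + n) = i + m)
    (M : CObj L) : (M.up n).rename ξ = M.up m := by
  rw [CObj.up, CObj.rename_rename, CObj.up]
  congr 1
  funext i
  exact h i

theorem hsubCObj_up {M₀ : CObj L} {k n : ℕ} {ρ₀ : STy L} {M M' : CObj L} (h : k ≤ n) :
    HSubCObj M₀ k ρ₀ (M.up (n + 1)) M' ↔ M' = M.up n := by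
  rw [← hsubCObj_skipRen (M₀ := M₀) (k := k) (ρ₀ := ρ₀) (M.up n), CObj.rename_up_of_add]
  intro i
  simp [skipRen, show ¬ i + n < k by omega]; rfl

/-! ### The head of a family -/

def AFam.head : AFam L → L.fam
  | .con a => a
  | .app α _ => α.head

/-- The family constant at the end of a family. -/
def Fam.head : Fam L → L.fam
  | .atom α => α.head
  | .pi _ τ => τ.head
  | .lock _ _ _ ρ => ρ.head

theorem HSubAFam.head_eq {M₀ : CObj L} {k : ℕ} {ρ₀ : STy L} :
    ∀ {α α' : AFam L}, HSubAFam M₀ k ρ₀ α α' → α'.head = α.head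
  | .con a, _, h => by rw [hsubAFam_con.1 h]
  | .app α N, _, h => by
      obtain ⟨_, _, h', -, rfl⟩ := hsubAFam_app.1 h
      exact (HSubAFam.head_eq (α := α) h' :)

theorem HSubFam.head_eq :
    ∀ {σ σ' : Fam L} {M₀ : CObj L} {k : ℕ} {ρ₀ : STy L},
      HSubFam M₀ k ρ₀ σ σ' → σ'.head = σ.head
  | .atom α, _, _, _, _, h => by
      obtain ⟨_, h', rfl⟩ := hsubFam_atom.1 h
      exact h'.head_eq
  | .pi σ τ, _, _, _, _, h => by
      obtain ⟨_, _, -, h', rfl⟩ := hsubFam_pi.1 h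
      exact (HSubFam.head_eq (σ := τ) h' :)
  | .lock P N σ ρ, _, _, _, _, h => by
      obtain ⟨_, _, _, -, -, h', rfl⟩ := hsubFam_lock.1 h
      exact (HSubFam.head_eq (σ := ρ) h' :)

/-! ### Typing: inversion -/

section Typing

variable {I : Interp L} {S : Sig L} {Γ : Ctx L}

theorem synth_con_inv {c : L.obj} {σ : Fam L} (h : Synth I S Γ (.con c) σ) :
    Decl.obj c σ ∈ S := by
  cases h with | con _ h => exact h

theorem synth_var_inv {i : ℕ} {τ : Fam L} (h : Synth I S Γ (.var i) τ) :
    ∃ σ, Γ[i]? = some σ ∧ τ = σ.rename (· + (i + 1)) := by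
  cases h with | var _ h => exact ⟨_, h, rfl⟩

theorem synth_app_inv {A : AObj L} {M : CObj L} {τ : Fam L} (h : Synth I S Γ (.app A M) τ) :
    ∃ σ τ₁, Synth I S Γ A (.pi σ τ₁) ∧ Check I S Γ M σ ∧ HSubFam M 0 σ.erase τ₁ τ := by
  cases h with | app h₁ h₂ h₃ => exact ⟨_, _, h₁, h₂, h₃⟩

theorem synth_unlock_inv {P : L.pred} {N : CObj L} {σ ρ : Fam L} {A : AObj L}
    (h : Synth I S Γ (.unlock P N σ A) ρ) : Synth I S Γ A (.lock P N σ ρ) := by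
  cases h with | unlock h => exact h

theorem check_atom_inv {A : AObj L} {σ : Fam L} (h : Check I S Γ (.atom A) σ) :
    Synth I S Γ A σ := by
  cases h with | atom h => exact h

theorem check_lam_inv {σ σ' τ : Fam L} {M : CObj L}
    (h : Check I S Γ (.lam σ M) (.pi σ' τ)) : σ = σ' ∧ Check I S (σ' :: Γ) M τ := by
  cases h with | lam h => exact ⟨rfl, h⟩

end Typing

end CLLFP

namespace FPST

open CLLFP

/-! ### Individual terms and formulas -/

mutual

theorem Tm.rename_eq_self {ξ : ℕ → ℕ} {k : ℕ} (hξ : ∀ i < k, ξ i = i) :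
    ∀ t : Tm, t.Below k → t.rename ξ = t
  | .var i, h => by simp [Tm.rename, hξ i h]
  | .set A, h => by
      rw [Tm.rename, Fm.rename_eq_self (k := k + 1) _ A h]
      rintro (_ | i) hi
      · rfl
      · simp [liftRen, hξ i (by omega)]

theorem Fm.rename_eq_self {ξ : ℕ → ℕ} {k : ℕ} (hξ : ∀ i < k, ξ i = i) :
    ∀ A : Fm, A.Below k → A.rename ξ = A
  | .letter _, _ => rfl
  | .mem t s, h => by
      rw [Fm.rename, Tm.rename_eq_self hξ t h.1, Tm.rename_eq_self hξ s h.2]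
  | .imp A B, h => by
      rw [Fm.rename, Fm.rename_eq_self hξ A h.1, Fm.rename_eq_self hξ B h.2]

end

mutual

theorem Tm.below_mono {k l : ℕ} (hkl : k ≤ l) : ∀ t : Tm, t.Below k → t.Below l
  | .var _, h => lt_of_lt_of_le h hkl
  | .set A, h => Fm.below_mono (Nat.succ_le_succ hkl) A h

theorem Fm.below_mono {k l : ℕ} (hkl : k ≤ l) : ∀ A : Fm, A.Below k → A.Below l
  | .letter _, _ => trivial
  | .mem t s, h => ⟨Tm.below_mono hkl t h.1, Tm.below_mono hkl s h.2⟩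
  | .imp A B, h => ⟨Fm.below_mono hkl A h.1, Fm.below_mono hkl B h.2⟩

end

/-- The substitution of `t` for the variable `k`, which disappears. -/
def single (t : Tm) (k i : ℕ) : Tm :=
  if i < k then .var i else if i = k then t else .var (i - 1)

theorem Fm.inst_eq_subst_single (A : Fm) (t : Tm) : A.inst t = A.subst (single t 0) := by
  unfold Fm.inst
  congr 1
  funext i
  cases i <;> simp [single]

theorem liftSub_single (t : Tm) (k : ℕ) :
    liftSub (single t k) = single (t.rename Nat.succ) (k + 1) := by
  funext i
  cases i with
  | zero => simp [liftSub, single]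
  | succ i =>
    simp only [liftSub, single, Nat.add_lt_add_iff_right, Nat.add_right_cancel_iff]
    split_ifs with h₁ h₂
    · rfl
    · rfl
    · simp only [Tm.rename]; congr 1; omega

mutual

theorem Tm.subst_eq_rename {θ : ℕ → Tm} {ξ : ℕ → ℕ} {k : ℕ}
    (hθ : ∀ i < k, θ i = .var (ξ i)) : ∀ t : Tm, t.Below k → t.subst θ = t.rename ξ
  | .var i, h => by rw [Tm.subst, hθ i h, Tm.rename]
  | .set A, h => by
      rw [Tm.subst, Fm.subst_eq_rename (k := k + 1) _ A h, Tm.rename]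
      rintro (_ | i) hi
      · rfl
      · simp [liftSub, hθ i (by omega), Tm.rename, liftRen]

theorem Fm.subst_eq_rename {θ : ℕ → Tm} {ξ : ℕ → ℕ} {k : ℕ}
    (hθ : ∀ i < k, θ i = .var (ξ i)) : ∀ A : Fm, A.Below k → A.subst θ = A.rename ξ
  | .letter _, _ => rfl
  | .mem t s, h => by
      rw [Fm.subst, Tm.subst_eq_rename hθ t h.1, Tm.subst_eq_rename hθ s h.2, Fm.rename]
  | .imp A B, h => by
      rw [Fm.subst, Fm.subst_eq_rename hθ A h.1, Fm.subst_eq_rename hθ B h.2, Fm.rename]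

end

mutual

theorem Tm.rename_subst {θ θ' : ℕ → Tm} {ξ : ℕ → ℕ} {k : ℕ}
    (hθ : ∀ i < k, θ (ξ i) = θ' i) : ∀ t : Tm, t.Below k → (t.rename ξ).subst θ = t.subst θ'
  | .var i, h => by rw [Tm.rename, Tm.subst, hθ i h, Tm.subst]
  | .set A, h => by
      rw [Tm.rename, Tm.subst, Fm.rename_subst (k := k + 1) (θ' := liftSub θ') _ A h, Tm.subst]
      rintro (_ | i) hi
      · rfl
      · simp [liftSub, liftRen, hθ i (by omega)]

theorem Fm.rename_subst {θ θ' : ℕ → Tm} {ξ : ℕ → ℕ} {k : ℕ}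
    (hθ : ∀ i < k, θ (ξ i) = θ' i) : ∀ A : Fm, A.Below k → (A.rename ξ).subst θ = A.subst θ'
  | .letter _, _ => rfl
  | .mem t s, h => by
      rw [Fm.rename, Fm.subst, Tm.rename_subst hθ t h.1, Tm.rename_subst hθ s h.2, Fm.subst]
  | .imp A B, h => by
      rw [Fm.rename, Fm.subst, Fm.rename_subst hθ A h.1, Fm.rename_subst hθ B h.2, Fm.subst]

end

theorem Fm.subst_eq_self {θ : ℕ → Tm} {k : ℕ} (hθ : ∀ i < k, θ i = .var i) {A : Fm}
    (hA : A.Below k) : A.subst θ = A := by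
  rw [A.subst_eq_rename (ξ := id) hθ hA, A.rename_eq_self (ξ := id) (k := k) (fun _ _ => rfl) hA]

theorem Fm.subst_single_var {A : Fm} (hA : A.Below 1) (j : ℕ) :
    A.subst (single (.var j) 0) = A.rename (· + j) :=
  A.subst_eq_rename (k := 1) (by intro i hi; simp [single, Nat.lt_one_iff.1 hi]) hA

theorem Fm.rename_add_subst_single {A : Fm} (hA : A.Below 1) (t : Tm) (j : ℕ) :
    (A.rename (· + j)).subst (single t j) = A.inst t := by
  rw [Fm.inst_eq_subst_single]
  exact A.rename_subst (k := 1) (by intro i hi; simp [single, Nat.lt_one_iff.1 hi]) hA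

/-- All free individual variables are smaller than `k`, and all letters belong to `As`. -/
def Tm.Good (As : List ℕ) (k : ℕ) (t : Tm) : Prop := t.Below k ∧ ∀ p ∈ t.letters, p ∈ As

/-- All free individual variables are smaller than `k`, and all letters belong to `As`. -/
def Fm.Good (As : List ℕ) (k : ℕ) (A : Fm) : Prop := A.Below k ∧ ∀ p ∈ A.letters, p ∈ As

section Good

variable {As : List ℕ} {k : ℕ}

@[simp] theorem Tm.good_var {i : ℕ} : (Tm.var i).Good As k ↔ i < k := by
  simp [Tm.Good, Tm.Below, Tm.letters]

@[simp] theorem Tm.good_set {A : Fm} : (Tm.set A).Good As k ↔ A.Good As (k + 1) := Iff.rfl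

@[simp] theorem Fm.good_letter {p : ℕ} : (Fm.letter p).Good As k ↔ p ∈ As := by
  simp [Fm.Good, Fm.Below, Fm.letters]

@[simp] theorem Fm.good_mem {t s : Tm} :
    (Fm.mem t s).Good As k ↔ t.Good As k ∧ s.Good As k := by
  simp only [Fm.Good, Tm.Good, Fm.Below, Fm.letters, Set.mem_union]
  grind

@[simp] theorem Fm.good_imp {A B : Fm} :
    (Fm.imp A B).Good As k ↔ A.Good As k ∧ B.Good As k := by
  simp only [Fm.Good, Fm.Below, Fm.letters, Set.mem_union]
  grind

end Good

mutual

theorem Tm.Good.subst {As : List ℕ} {t : Tm} (ht : t.Good As 0) :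
    ∀ {k : ℕ} (s : Tm), s.Good As (k + 1) → (s.subst (single t k)).Good As k
  | k, .var i, h => by
      rw [Tm.good_var] at h
      simp only [Tm.subst, single]
      split_ifs with h₁ h₂
      · simpa
      · exact ⟨t.below_mono (Nat.zero_le k) ht.1, ht.2⟩
      · omega
  | k, .set A, h => by
      rw [Tm.subst, liftSub_single, Tm.good_set]
      rw [Tm.rename_eq_self (k := 0) (by simp) t ht.1]
      exact Fm.Good.subst ht A h

theorem Fm.Good.subst {As : List ℕ} {t : Tm} (ht : t.Good As 0) :
    ∀ {k : ℕ} (A : Fm), A.Good As (k + 1) → (A.subst (single t k)).Good As k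
  | k, .letter p, h => by simpa [Fm.subst] using h
  | k, .mem s u, h => by
      rw [Fm.good_mem] at h
      rw [Fm.subst, Fm.good_mem]
      exact ⟨Tm.Good.subst ht s h.1, Tm.Good.subst ht u h.2⟩
  | k, .imp A B, h => by
      rw [Fm.good_imp] at h
      rw [Fm.subst, Fm.good_imp]
      exact ⟨Fm.Good.subst ht A h.1, Fm.Good.subst ht B h.2⟩

end

theorem Fm.Good.inst {As : List ℕ} {t : Tm} {A : Fm} (hA : A.Good As 1) (ht : t.Good As 0) :
    (A.inst t).Good As 0 := by
  rw [Fm.inst_eq_subst_single]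
  exact Fm.Good.subst ht A hA

/-! ### Elimination of foreign letters and of free variables -/

/-- The closed term `λx. x ∈ x`. -/
def russell : Tm := .set (.mem (.var 0) (.var 0))

mutual

/-- Replacement of the variables from `k` on by `russell`, and of the letters outside `As` by
`russell ∈ russell`. -/
def Tm.clean (As : List ℕ) : ℕ → Tm → Tm
  | k, .var i => if i < k then .var i else russell
  | k, .set A => .set (A.clean As (k + 1))

/-- Replacement of the variables from `k` on by `russell`, and of the letters outside `As` by
`russell ∈ russell`. -/
def Fm.clean (As : List ℕ) : ℕ → Fm → Fm
  | _, .letter p => if p ∈ As then .letter p else .mem russell russell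
  | k, .mem t s => .mem (t.clean As k) (s.clean As k)
  | k, .imp A B => .imp (A.clean As k) (B.clean As k)

end

theorem russell_good {As : List ℕ} {k : ℕ} : russell.Good As k := by
  simp [russell]

mutual

theorem Tm.clean_good {As : List ℕ} : ∀ (k : ℕ) (t : Tm), (t.clean As k).Good As k
  | k, .var i => by
      rw [Tm.clean]
      split_ifs with h
      · simpa
      · exact russell_good
  | k, .set A => Fm.clean_good (k + 1) A

theorem Fm.clean_good {As : List ℕ} : ∀ (k : ℕ) (A : Fm), (A.clean As k).Good As k
  | k, .letter p => by
      rw [Fm.clean]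
      split_ifs with h
      · simpa
      · exact Fm.good_mem.2 ⟨russell_good, russell_good⟩
  | k, .mem t s => Fm.good_mem.2 ⟨Tm.clean_good k t, Tm.clean_good k s⟩
  | k, .imp A B => Fm.good_imp.2 ⟨Fm.clean_good k A, Fm.clean_good k B⟩

end

mutual

theorem Tm.Good.clean_eq {As : List ℕ} :
    ∀ {k : ℕ} (t : Tm), t.Good As k → t.clean As k = t
  | k, .var i, h => by rw [Tm.clean, if_pos (Tm.good_var.1 h)]
  | k, .set A, h => by rw [Tm.clean, Fm.Good.clean_eq A h]

theorem Fm.Good.clean_eq {As : List ℕ} :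
    ∀ {k : ℕ} (A : Fm), A.Good As k → A.clean As k = A
  | k, .letter p, h => by rw [Fm.clean, if_pos (Fm.good_letter.1 h)]
  | k, .mem t s, h => by
      rw [Fm.clean, Tm.Good.clean_eq t (Fm.good_mem.1 h).1,
        Tm.Good.clean_eq s (Fm.good_mem.1 h).2]
  | k, .imp A B, h => by
      rw [Fm.clean, Fm.Good.clean_eq A (Fm.good_imp.1 h).1,
        Fm.Good.clean_eq B (Fm.good_imp.1 h).2]

end

mutual

theorem Tm.clean_rename {As : List ℕ} {ξ : ℕ → ℕ} {k l : ℕ} (hξ : ∀ i, ξ i < l ↔ i < k) :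
    ∀ t : Tm, (t.rename ξ).clean As l = (t.clean As k).rename ξ
  | .var i => by
      simp only [Tm.rename, Tm.clean, hξ]
      split_ifs <;> rfl
  | .set A => by
      simp only [Tm.rename, Tm.clean]
      rw [Fm.clean_rename (k := k + 1) _ A]
      rintro (_ | i) <;> simp [liftRen, hξ]

theorem Fm.clean_rename {As : List ℕ} {ξ : ℕ → ℕ} {k l : ℕ} (hξ : ∀ i, ξ i < l ↔ i < k) :
    ∀ A : Fm, (A.rename ξ).clean As l = (A.clean As k).rename ξ
  | .letter p => by
      simp only [Fm.rename, Fm.clean]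
      split_ifs <;> rfl
  | .mem t s => by
      simp only [Fm.rename, Fm.clean, Tm.clean_rename hξ t, Tm.clean_rename hξ s]
  | .imp A B => by
      simp only [Fm.rename, Fm.clean, Fm.clean_rename hξ A, Fm.clean_rename hξ B]

end

mutual

theorem Tm.clean_subst {As : List ℕ} {θ θ' : ℕ → Tm} {k l : ℕ}
    (hθ : ∀ i, (θ i).clean As l = if i < k then θ' i else russell) :
    ∀ t : Tm, (t.subst θ).clean As l = (t.clean As k).subst θ'
  | .var i => by
      simp only [Tm.subst, Tm.clean, hθ]
      split_ifs <;> rfl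
  | .set A => by
      simp only [Tm.subst, Tm.clean]
      rw [Fm.clean_subst (k := k + 1) _ A]
      rintro (_ | i)
      · simp [liftSub, Tm.clean]
      · simp only [liftSub, Nat.add_lt_add_iff_right]
        rw [Tm.clean_rename (k := l) (by simp), hθ]
        split_ifs <;> rfl

theorem Fm.clean_subst {As : List ℕ} {θ θ' : ℕ → Tm} {k l : ℕ}
    (hθ : ∀ i, (θ i).clean As l = if i < k then θ' i else russell) :
    ∀ A : Fm, (A.subst θ).clean As l = (A.clean As k).subst θ'
  | .letter p => by
      simp only [Fm.subst, Fm.clean]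
      split_ifs <;> rfl
  | .mem t s => by
      simp only [Fm.subst, Fm.clean, Tm.clean_subst hθ t, Tm.clean_subst hθ s]
  | .imp A B => by
      simp only [Fm.subst, Fm.clean, Fm.clean_subst hθ A, Fm.clean_subst hθ B]

end

theorem Fm.clean_inst (As : List ℕ) (A : Fm) (t : Tm) :
    (A.inst t).clean As 0 = (A.clean As 1).inst (t.clean As 0) := by
  unfold Fm.inst
  apply Fm.clean_subst
  rintro (_ | i) <;> simp [Tm.clean]

/-! ### Subject reduction -/

theorem Quasi.rename {Γ : List Fm} {p : Prf} {A : Fm} (h : Quasi Γ p A) :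
    ∀ {Δ : List Fm} {ξ : ℕ → ℕ}, (∀ i B, Γ[i]? = some B → Δ[ξ i]? = some B) →
      Quasi Δ (p.rename ξ) A := by
  induction h with
  | hyp h => intro Δ ξ hξ; exact .hyp (hξ _ _ h)
  | impI _ ih =>
    intro Δ ξ hξ
    refine .impI (ih ?_)
    rintro (_ | i) B hB
    · exact hB
    · exact hξ i B hB
  | impE _ _ ih₁ ih₂ => intro Δ ξ hξ; exact .impE (ih₁ hξ) (ih₂ hξ)
  | lamI _ ih => intro Δ ξ hξ; exact .lamI (ih hξ)
  | lamE _ ih => intro Δ ξ hξ; exact .lamE (ih hξ)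

theorem Quasi.subst {Γ : List Fm} {p : Prf} {A : Fm} (h : Quasi Γ p A) :
    ∀ {Δ : List Fm} {θ : ℕ → Prf}, (∀ i B, Γ[i]? = some B → Quasi Δ (θ i) B) →
      Quasi Δ (p.subst θ) A := by
  induction h with
  | hyp h => intro Δ θ hθ; exact hθ _ _ h
  | impI _ ih =>
    intro Δ θ hθ
    refine .impI (ih ?_)
    rintro (_ | i) B hB
    · exact .hyp hB
    · exact (hθ i B hB).rename fun _ _ h => h
  | impE _ _ ih₁ ih₂ => intro Δ θ hθ; exact .impE (ih₁ hθ) (ih₂ hθ)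
  | lamI _ ih => intro Δ θ hθ; exact .lamI (ih hθ)
  | lamE _ ih => intro Δ θ hθ; exact .lamE (ih hθ)

theorem Quasi.step {p q : Prf} (h : Prf.Step p q) :
    ∀ {Γ : List Fm} {A : Fm}, Quasi Γ p A → Quasi Γ q A := by
  induction h with
  | imp =>
    intro Γ A h
    cases h with | impE h₁ h₂ => ?_
    cases h₂ with | impI h₂ => ?_
    refine h₂.subst ?_
    rintro (_ | i) B hB
    · cases hB; exact h₁
    · exact .hyp hB
  | lam =>
    intro Γ A h
    cases h with | lamE h => ?_
    cases h with | lamI h => exact h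
  | impI _ ih => intro Γ A h; cases h with | impI h => exact .impI (ih h)
  | impE_left _ ih => intro Γ A h; cases h with | impE h₁ h₂ => exact .impE (ih h₁) h₂
  | impE_right _ ih => intro Γ A h; cases h with | impE h₁ h₂ => exact .impE h₁ (ih h₂)
  | lamI _ ih => intro Γ A h; cases h with | lamI h => exact .lamI (ih h)
  | lamE _ ih => intro Γ A h; cases h with | lamE h => exact .lamE (ih h)

theorem Quasi.steps {Γ : List Fm} {A : Fm} {p q : Prf}
    (h : Relation.ReflTransGen Prf.Step p q) (hp : Quasi Γ p A) : Quasi Γ q A := by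
  induction h with
  | refl => exact hp
  | tail _ h ih => exact ih.step h

/-! ### Encodings -/

mutual

theorem Tm.enc_rename (ξ : ℕ → ℕ) :
    ∀ (e : ℕ → ℕ) (t : Tm), (t.enc e).rename ξ = (t.rename ξ).enc (fun p => ξ (e p))
  | _, .var _ => rfl
  | e, .set A => by
      simp [Tm.enc, Tm.rename, CObj.rename, AObj.rename, Fam.rename, AFam.rename,
        Fm.enc_rename _ _ A, liftRen]

theorem Fm.enc_rename (ξ : ℕ → ℕ) :
    ∀ (e : ℕ → ℕ) (A : Fm), (A.enc e).rename ξ = (A.rename ξ).enc (fun p => ξ (e p))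
  | _, .letter _ => rfl
  | e, .mem t s => by
      simp [Fm.enc, Fm.rename, CObj.rename, AObj.rename, Tm.enc_rename ξ e t,
        Tm.enc_rename ξ e s]
  | e, .imp A B => by
      simp [Fm.enc, Fm.rename, CObj.rename, AObj.rename, Fm.enc_rename ξ e A,
        Fm.enc_rename ξ e B]

end

theorem Tm.enc_rename_of_below {t : Tm} (ht : t.Below 0) (ξ e : ℕ → ℕ) :
    (t.enc e).rename ξ = t.enc (fun p => ξ (e p)) := by
  rw [Tm.enc_rename, t.rename_eq_self (k := 0) (by simp) ht]

theorem Fm.enc_rename_of_below {A : Fm} (hA : A.Below 0) (ξ e : ℕ → ℕ) :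
    (A.enc e).rename ξ = A.enc (fun p => ξ (e p)) := by
  rw [Fm.enc_rename, A.rename_eq_self (k := 0) (by simp) hA]

theorem Fm.enc_rename_liftRen {A : Fm} (hA : A.Below 1) (ξ e : ℕ → ℕ) :
    (A.enc fun p => e p + 1).rename (liftRen ξ) = A.enc (fun p => ξ (e p) + 1) := by
  rw [Fm.enc_rename, A.rename_eq_self (k := 1) _ hA]
  · rfl
  · intro i hi; rw [Nat.lt_one_iff.1 hi]; rfl

mutual

theorem Tm.enc_inj {As : List ℕ} {e : ℕ → ℕ} (he : ∀ p ∈ As, ∀ q ∈ As, e p = e q → p = q) :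
    ∀ {t s : Tm}, (∀ p ∈ t.letters, p ∈ As) → (∀ p ∈ s.letters, p ∈ As) →
      t.enc e = s.enc e → t = s
  | .var i, .var j, _, _, h => by simpa [Tm.enc] using h
  | .var i, .set A, _, _, h => by simp [Tm.enc] at h
  | .set A, .var i, _, _, h => by simp [Tm.enc] at h
  | .set A, .set B, hA, hB, h => by
      simp only [Tm.enc, CObj.atom.injEq, AObj.app.injEq, CObj.lam.injEq, true_and] at h
      rw [Fm.enc_inj (e := fun p => e p + 1)
        (fun p hp q hq h => he p hp q hq (Nat.succ_injective h)) hA hB h]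

theorem Fm.enc_inj {As : List ℕ} {e : ℕ → ℕ} (he : ∀ p ∈ As, ∀ q ∈ As, e p = e q → p = q) :
    ∀ {A B : Fm}, (∀ p ∈ A.letters, p ∈ As) → (∀ p ∈ B.letters, p ∈ As) →
      A.enc e = B.enc e → A = B
  | .letter p, .letter q, hA, hB, h => by
      simp only [Fm.enc, CObj.atom.injEq, AObj.var.injEq] at h
      rw [he p (hA p rfl) q (hB q rfl) h]
  | .letter p, .mem _ _, _, _, h => by simp [Fm.enc] at h
  | .letter p, .imp _ _, _, _, h => by simp [Fm.enc] at h
  | .mem _ _, .letter _, _, _, h => by simp [Fm.enc] at h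
  | .mem _ _, .imp _ _, _, _, h => by simp [Fm.enc] at h
  | .imp _ _, .letter _, _, _, h => by simp [Fm.enc] at h
  | .imp _ _, .mem _ _, _, _, h => by simp [Fm.enc] at h
  | .mem t s, .mem t' s', hA, hB, h => by
      simp only [Fm.enc, CObj.atom.injEq, AObj.app.injEq, true_and] at h
      rw [Tm.enc_inj he (fun p hp => hA p (.inl hp)) (fun p hp => hB p (.inl hp)) h.1,
        Tm.enc_inj he (fun p hp => hA p (.inr hp)) (fun p hp => hB p (.inr hp)) h.2]
  | .imp A B, .imp A' B', hA, hB, h => by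
      simp only [Fm.enc, CObj.atom.injEq, AObj.app.injEq, true_and] at h
      rw [Fm.enc_inj he (fun p hp => hA p (.inl hp)) (fun p hp => hB p (.inl hp)) h.1,
        Fm.enc_inj he (fun p hp => hA p (.inr hp)) (fun p hp => hB p (.inr hp)) h.2]

end

mutual

theorem hsub_tm_enc :
    ∀ (s : Tm) {t : Tm} {e : ℕ → ℕ} {k : ℕ} {ρ₀ : STy names} {M : CObj names},
      (∀ p, k ≤ e p) →
      (HSubCObj (t.enc e) k ρ₀ (s.enc fun p => e p + 1) M ↔
        M = (s.subst (single t k)).enc e)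
  | .var i, t, e, k, ρ₀, M, he => by
      simp only [Tm.enc, Tm.subst, single, hsubCObj_atom, hsubAObj_var, hsubHead_var]
      rcases lt_trichotomy i k with h | rfl | h
      · simp [h, h.ne, h.not_gt, Tm.enc]
      · simp
      · simp [h, h.ne', h.not_gt, Tm.enc]
  | .set A, t, e, k, ρ₀, M, he => by
      simp only [Tm.enc, Tm.subst, hsubCObj_atom, hsubAObj_app, hsubAObj_con, hsubHead_app,
        hsubHead_con, hsubCObj_lam, hsubFam_atom, hsubAFam_con, liftSub_single,
        CObj.shift, Tm.enc_rename]
      simp [hsub_fm_enc A (e := fun p => e p + 1) (k := k + 1) (by simpa using he)]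

theorem hsub_fm_enc :
    ∀ (A : Fm) {t : Tm} {e : ℕ → ℕ} {k : ℕ} {ρ₀ : STy names} {M : CObj names},
      (∀ p, k ≤ e p) →
      (HSubCObj (t.enc e) k ρ₀ (A.enc fun p => e p + 1) M ↔
        M = (A.subst (single t k)).enc e)
  | .letter p, t, e, k, ρ₀, M, he => by
      have := he p
      simp only [Fm.enc, Fm.subst, hsubCObj_atom, hsubAObj_var, hsubHead_var]
      simp [show ¬ e p + 1 < k by omega, show k < e p + 1 by omega,
        show ¬ e p + 1 = k by omega]
  | .mem s u, t, e, k, ρ₀, M, he => by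
      simp [Fm.enc, Fm.subst, hsubCObj_atom, hsubAObj_app, hsubAObj_con, hsubHead_app,
        hsubHead_con, hsub_tm_enc s he, hsub_tm_enc u he]
  | .imp A B, t, e, k, ρ₀, M, he => by
      simp [Fm.enc, Fm.subst, hsubCObj_atom, hsubAObj_app, hsubAObj_con, hsubHead_app,
        hsubHead_con, hsub_fm_enc A he, hsub_fm_enc B he]

end

end FPST

namespace CLLFP

variable {L : Names}

theorem CObj.up_up (n m : ℕ) (M : CObj L) : (M.up n).up m = M.up (n + m) :=
  CObj.rename_up_of_add (fun i => Nat.add_assoc i n m) M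

theorem check_var {I : Interp L} {S : Sig L} {Γ : Ctx L} {i : ℕ} {σ : Fam L} {α : AFam L}
    (hΓ : ValidCtx I S Γ) (h : Γ[i]? = some σ) (hσ : σ.rename (· + (i + 1)) = .atom α) :
    Check I S Γ (.atom (.var i)) (.atom α) :=
  .atom (hσ ▸ .var hΓ h)

theorem validFam_con {I : Interp L} {S : Sig L} {Γ : Ctx L} {a : L.fam}
    (hΓ : ValidCtx I S Γ) (h : Decl.fam a .type ∈ S) : ValidFam I S Γ (.atom (.con a)) :=
  .atom (.con hΓ h)

end CLLFP

namespace FPST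

open CLLFP

/-! ### Hereditary substitution into the types of the signature -/

theorem hsubFam_o {M : CObj names} {k : ℕ} {ρ₀ : STy names} {τ : Fam names} :
    HSubFam M k ρ₀ o τ ↔ τ = o := by
  simp [hsubFam_atom, hsubAFam_con]

theorem hsubFam_ind {M : CObj names} {k : ℕ} {ρ₀ : STy names} {τ : Fam names} :
    HSubFam M k ρ₀ ind τ ↔ τ = ind := by
  simp [hsubFam_atom, hsubAFam_con]

theorem hsubFam_T {M C : CObj names} {k : ℕ} {ρ₀ : STy names} {τ : Fam names} :
    HSubFam M k ρ₀ (T C) τ ↔ ∃ C', HSubCObj M k ρ₀ C C' ∧ τ = T C' := by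
  simp [hsubFam_atom, hsubAFam_con, hsubAFam_app]

theorem hsubFam_V {M C : CObj names} {k : ℕ} {ρ₀ : STy names} {τ : Fam names} :
    HSubFam M k ρ₀ (V C) τ ↔ ∃ C', HSubCObj M k ρ₀ C C' ∧ τ = V C' := by
  simp [hsubFam_atom, hsubAFam_con, hsubAFam_app]

theorem hsubCObj_impO {M A B C : CObj names} {k : ℕ} {ρ₀ : STy names} :
    HSubCObj M k ρ₀ (impO A B) C ↔
      ∃ A' B', HSubCObj M k ρ₀ A A' ∧ HSubCObj M k ρ₀ B B' ∧ C = impO A' B' := by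
  simp [hsubCObj_atom, hsubAObj_app, hsubAObj_con, hsubHead_app, hsubHead_con, and_assoc]

theorem hsubCObj_epsO {M A B C : CObj names} {k : ℕ} {ρ₀ : STy names} :
    HSubCObj M k ρ₀ (epsO A B) C ↔
      ∃ A' B', HSubCObj M k ρ₀ A A' ∧ HSubCObj M k ρ₀ B B' ∧ C = epsO A' B' := by
  simp [hsubCObj_atom, hsubAObj_app, hsubAObj_con, hsubHead_app, hsubHead_con, and_assoc]

theorem hsubCObj_lamO {M A C : CObj names} {k : ℕ} {ρ₀ : STy names} :
    HSubCObj M k ρ₀ (lamO A) C ↔ ∃ A', HSubCObj M k ρ₀ A A' ∧ C = lamO A' := by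
  simp [hsubCObj_atom, hsubAObj_app, hsubAObj_con, hsubHead_app, hsubHead_con]

theorem hsubCObj_vr_lt {M C : CObj names} {k i : ℕ} {ρ₀ : STy names} (h : i < k) :
    HSubCObj M k ρ₀ (vr i) C ↔ C = vr i := by
  simp [hsubCObj_atom, hsubAObj_var, hsubHead_var, h, h.ne, h.not_gt]

theorem hsubCObj_vr_self {M C : CObj names} {k : ℕ} {ρ₀ : STy names} :
    HSubCObj M k ρ₀ (vr k) C ↔ C = M := by
  simp [hsubCObj_atom, hsubAObj_var, hsubHead_var]

theorem hsubCObj_atom_app_var {M x y C : CObj names} {k : ℕ} {ρ₀ : STy names} :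
    HSubCObj M (k + 1) ρ₀ (.atom (.app (.app (.var 0) x) y)) C ↔
      ∃ x' y', HSubCObj M (k + 1) ρ₀ x x' ∧ HSubCObj M (k + 1) ρ₀ y y' ∧
        C = .atom (.app (.app (.var 0) x') y') := by
  simp [hsubCObj_atom, hsubAObj_app, hsubAObj_var, hsubHead_app, hsubHead_var, and_assoc]

theorem hsubFam_delta {C : CObj names} {ρ₀ : STy names} {τ : Fam names} :
    HSubFam C 0 ρ₀ (.pi (V (vr 0)) (T (vr 1))) τ ↔ τ = .pi (V C) (T (C.up 1)) := by
  simp only [hsubFam_pi, hsubFam_T, hsubFam_V, hsubCObj_vr_self, CObj.shift_eq_up]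
  simp

theorem hsubFam_T_up {M C : CObj names} {k n : ℕ} (h : k ≤ n) {ρ₀ : STy names}
    {τ : Fam names} : HSubFam M k ρ₀ (T (C.up (n + 1))) τ ↔ τ = T (C.up n) := by
  simp [hsubFam_T, hsubCObj_up h]

theorem hsubFam_impIntro₁ {A : CObj names} {ρ₀ : STy names} {τ : Fam names} :
    HSubFam A 0 ρ₀ (.pi o (.pi (.pi (V (vr 1)) (T (vr 1))) (T (impO (vr 2) (vr 1))))) τ ↔
      τ = .pi o (.pi (.pi (V (A.up 1)) (T (vr 1))) (T (impO (A.up 2) (vr 1)))) := by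
  simp [hsubFam_pi, hsubFam_T, hsubFam_V, hsubFam_o, hsubCObj_impO, hsubCObj_vr_self,
    hsubCObj_vr_lt, CObj.shift_eq_up, CObj.up_up]

theorem hsubFam_impIntro₂ {A B : CObj names} {ρ₀ : STy names} {τ : Fam names} :
    HSubFam B 0 ρ₀ (.pi (.pi (V (A.up 1)) (T (vr 1))) (T (impO (A.up 2) (vr 1)))) τ ↔
      τ = .pi (.pi (V A) (T (B.up 1))) (T (impO (A.up 1) (B.up 1))) := by
  simp [hsubFam_pi, hsubFam_T, hsubFam_V, hsubCObj_impO, hsubCObj_vr_self,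
    CObj.shift_eq_up, hsubCObj_up, CObj.up_zero]

theorem hsubFam_T_impO_up {M A B : CObj names} {k n m : ℕ} (hn : k ≤ n) (hm : k ≤ m)
    {ρ₀ : STy names} {τ : Fam names} :
    HSubFam M k ρ₀ (T (impO (A.up (n + 1)) (B.up (m + 1)))) τ ↔
      τ = T (impO (A.up n) (B.up m)) := by
  simp [hsubFam_T, hsubCObj_impO, hsubCObj_up hn, hsubCObj_up hm]

theorem up_vr (n i : ℕ) : CObj.up n (vr i) = vr (i + n) := rfl

theorem fitchLock_eq (A B x y : CObj names) :
    fitchLock A B x y = .lock PredName.fitch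
      (.lam (.pi (T A) (.pi (T (impO (A.up 1) (B.up 1))) o))
        (.atom (.app (.app (.var 0) (x.up 1)) (y.up 1))))
      (.pi (.pi (T A) (.pi (T (impO (A.up 1) (B.up 1))) o)) o) (T B) := rfl

theorem hsubFam_impElim₁ {A : CObj names} {ρ₀ : STy names} {τ : Fam names} :
    HSubFam A 0 ρ₀ (.pi o (.pi (T (vr 1)) (.pi (T (impO (vr 2) (vr 1)))
      (fitchLock (vr 3) (vr 2) (vr 1) (vr 0))))) τ ↔
      τ = .pi o (.pi (T (A.up 1)) (.pi (T (impO (A.up 2) (vr 1)))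
        (fitchLock (A.up 3) (vr 2) (vr 1) (vr 0)))) := by
  simp [fitchLock_eq, hsubFam_pi, hsubFam_T, hsubFam_o, hsubCObj_impO, hsubCObj_vr_self,
    hsubCObj_vr_lt, CObj.shift_eq_up, CObj.up_up, hsubFam_lock, hsubCObj_lam,
    hsubCObj_atom_app_var, up_vr]

theorem hsubFam_impElim₂ {A B : CObj names} {ρ₀ : STy names} {τ : Fam names} :
    HSubFam B 0 ρ₀ (.pi (T (A.up 1)) (.pi (T (impO (A.up 2) (vr 1)))
      (fitchLock (A.up 3) (vr 2) (vr 1) (vr 0)))) τ ↔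
      τ = .pi (T A) (.pi (T (impO (A.up 1) (B.up 1)))
        (fitchLock (A.up 2) (B.up 2) (vr 1) (vr 0))) := by
  simp [fitchLock_eq, hsubFam_pi, hsubFam_T, hsubFam_o, hsubCObj_impO, hsubCObj_vr_self,
    hsubCObj_vr_lt, CObj.shift_eq_up, CObj.up_up, hsubFam_lock, hsubCObj_up, hsubCObj_lam,
    hsubCObj_atom_app_var, up_vr, CObj.up_zero]

theorem hsubFam_impElim₃ {A B x : CObj names} {ρ₀ : STy names} {τ : Fam names} :
    HSubFam x 0 ρ₀ (.pi (T (impO (A.up 1) (B.up 1)))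
      (fitchLock (A.up 2) (B.up 2) (vr 1) (vr 0))) τ ↔
      τ = .pi (T (impO A B)) (fitchLock (A.up 1) (B.up 1) (x.up 1) (vr 0)) := by
  simp [fitchLock_eq, hsubFam_pi, hsubFam_T, hsubFam_o, hsubCObj_impO, hsubCObj_vr_self,
    hsubCObj_vr_lt, CObj.shift_eq_up, CObj.up_up, hsubFam_lock, hsubCObj_up, hsubCObj_lam,
    hsubCObj_atom_app_var, up_vr, CObj.up_zero]

theorem hsubFam_impElim₄ {A B x y : CObj names} {ρ₀ : STy names} {τ : Fam names} :
    HSubFam y 0 ρ₀ (fitchLock (A.up 1) (B.up 1) (x.up 1) (vr 0)) τ ↔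
      τ = fitchLock A B x y := by
  simp [fitchLock_eq, hsubFam_pi, hsubFam_T, hsubFam_o, hsubCObj_impO, hsubCObj_vr_self,
    CObj.shift_eq_up, CObj.up_up, hsubFam_lock, hsubCObj_up, hsubCObj_lam,
    hsubCObj_atom_app_var, up_vr, CObj.up_zero]

theorem hsubCObj_app_vr {F : Fm} {e : ℕ → ℕ} {j k : ℕ} {C : CObj names} (hF : F.Below 1)
    (hk : j < k) :
    HSubCObj (.lam ind (F.enc fun p => e p + 1)) k (.arr (.con FamName.ind) (.con FamName.o))
      (.atom (.app (.var k) (vr j))) C ↔ C = (F.rename (· + j)).enc e := by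
  have h := fun (C : CObj names) (ρ : STy names) =>
    hsub_fm_enc F (t := .var j) (e := e) (k := 0) (ρ₀ := ρ) (M := C) (by simp)
  simp only [Tm.enc, Fm.subst_single_var hF] at h
  rw [hsubCObj_atom]
  simp only [hsubAObj_app, hsubAObj_var, hsubHead_app, hsubHead_var, hsubCObj_vr_lt hk]
  constructor
  · rintro (⟨_, ⟨_, _, h, _⟩, _⟩ | ⟨_, _, _, _, ⟨_, h', _⟩, rfl, hC⟩)
    · omega
    · cases h'
      exact (h _ _).1 hC
  · rintro rfl
    exact .inr ⟨.con FamName.o, ind, _, vr j, ⟨trivial, rfl, rfl⟩, rfl, (h _ _).2 rfl⟩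

theorem lam_enc_shift {F : Fm} (hF : F.Below 1) (e : ℕ → ℕ) :
    (CObj.lam ind (F.enc fun p => e p + 1)).shift =
      .lam ind (F.enc fun p => e p + 1 + 1) := by
  simp [CObj.shift, CObj.rename, Fam.rename, AFam.rename, Fm.enc_rename_liftRen hF]

/-- The encoding of `λx.A` as an object of type `ι → o`. -/
abbrev encLam (e : ℕ → ℕ) (A : Fm) : CObj names := .lam ind (A.enc fun p => e p + 1)

/-- The simple type of `ι → o`. -/
abbrev indO : STy names := .arr (.con FamName.ind) (.con FamName.o)

theorem indO_shift : indO.shift = indO := rfl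

section Lam

variable {F : Fm} {e : ℕ → ℕ} {t : Tm} {τ : Fam names}

theorem hsubFam_lamIntro₁ (hF : F.Below 1) :
    HSubFam (encLam e F) 0 indO
      (.pi ind (.pi (T (.atom (.app (.var 1) (vr 0))))
        (T (epsO (vr 1) (lamO (.lam ind (.atom (.app (.var 3) (vr 0))))))))) τ ↔
      τ = .pi ind (.pi (T (F.enc fun p => e p + 1))
        (T (epsO (vr 1) (lamO (encLam (fun p => e p + 1 + 1) F))))) := by
  have h₁ := fun C => hsubCObj_app_vr (e := fun p => e p + 1) (j := 0) (k := 1) (C := C) hF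
    (by simp)
  have h₂ := fun C => hsubCObj_app_vr (e := fun p => e p + 1 + 1 + 1) (j := 0) (k := 3) (C := C)
    hF (by simp)
  have h₃ := F.rename_eq_self (ξ := (· + 0)) (k := 1) (by simp) hF
  simp only [h₃] at h₁ h₂
  simp [hsubFam_pi, hsubFam_T, hsubFam_ind, hsubCObj_epsO, hsubCObj_lamO,
    hsubCObj_lam, hsubCObj_vr_lt, lam_enc_shift hF, indO_shift, h₁, h₂]

theorem hsubFam_lamElim₁ (hF : F.Below 1) :
    HSubFam (encLam e F) 0 indO
      (.pi ind (.pi (T (epsO (vr 0) (lamO (.lam ind (.atom (.app (.var 2) (vr 0)))))))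
        (T (.atom (.app (.var 2) (vr 1)))))) τ ↔
      τ = .pi ind (.pi (T (epsO (vr 0) (lamO (encLam (fun p => e p + 1) F))))
        (T ((F.rename (· + 1)).enc fun p => e p + 1 + 1))) := by
  have h₁ := fun C => hsubCObj_app_vr (e := fun p => e p + 1 + 1) (j := 1) (k := 2) (C := C) hF
    (by simp)
  have h₂ := fun C => hsubCObj_app_vr (e := fun p => e p + 1 + 1) (j := 0) (k := 2) (C := C)
    hF (by simp)
  have h₃ := F.rename_eq_self (ξ := (· + 0)) (k := 1) (by simp) hF
  simp only [h₃] at h₂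
  simp [hsubFam_pi, hsubFam_T, hsubFam_ind, hsubCObj_epsO, hsubCObj_lamO,
    hsubCObj_lam, hsubCObj_vr_lt, lam_enc_shift hF, indO_shift, h₁, h₂]

theorem hsubCObj_encLam (hF : F.Below 1) {k : ℕ} (hk : ∀ p, k ≤ e p) {ρ₀ : STy names}
    {C : CObj names} (ht : t.Below 0) :
    HSubCObj (t.enc e) k ρ₀ (encLam (fun p => e p + 1) F) C ↔ C = encLam e F := by
  have := fun C ρ₀ => hsub_fm_enc F (t := t) (e := fun p => e p + 1) (k := k + 1) (M := C)
    (ρ₀ := ρ₀) (by simpa using hk)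
  rw [Fm.subst_eq_self (k := 1) (by intro i hi; simp [single]; omega) hF] at this
  simp [hsubCObj_lam, hsubFam_ind, Tm.enc_rename_of_below ht, this]

theorem hsubFam_lamIntro₂ (hF : F.Below 1) (ht : t.Below 0) {ρ₀ : STy names} :
    HSubFam (t.enc e) 0 ρ₀ (.pi (T (F.enc fun p => e p + 1))
        (T (epsO (vr 1) (lamO (encLam (fun p => e p + 1 + 1) F))))) τ ↔
      τ = .pi (T ((F.inst t).enc e)) (T (epsO (t.enc fun p => e p + 1)
        (lamO (encLam (fun p => e p + 1) F)))) := by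
  have h₁ := fun C => hsub_fm_enc F (t := t) (e := e) (k := 0) (M := C) (ρ₀ := ρ₀) (by simp)
  have h₂ := fun C => hsubCObj_encLam (t := t) (e := fun p => e p + 1) (k := 1) (C := C)
    (ρ₀ := ρ₀.shift) hF (by simp) ht
  rw [Fm.inst_eq_subst_single]
  simp only [hsubFam_pi, hsubFam_T, hsubCObj_epsO, hsubCObj_lamO, zero_add,
    hsubCObj_vr_self, Tm.enc_rename_of_below ht, h₁, h₂]
  simp

theorem hsubFam_lamElim₂ (hF : F.Below 1) (ht : t.Below 0) {ρ₀ : STy names} :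
    HSubFam (t.enc e) 0 ρ₀ (.pi (T (epsO (vr 0) (lamO (encLam (fun p => e p + 1) F))))
        (T ((F.rename (· + 1)).enc fun p => e p + 1 + 1))) τ ↔
      τ = .pi (T ((Fm.mem t (.set F)).enc e)) (T ((F.inst t).enc fun p => e p + 1)) := by
  have h₁ := fun C => hsub_fm_enc (F.rename (· + 1)) (t := t) (e := fun p => e p + 1) (k := 1)
    (M := C) (ρ₀ := ρ₀.shift) (by simp)
  have h₂ := fun C => hsubCObj_encLam (t := t) (e := e) (k := 0) (C := C)
    (ρ₀ := ρ₀) hF (by simp) ht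
  rw [Fm.rename_add_subst_single hF] at h₁
  simp only [hsubFam_pi, hsubFam_T, hsubCObj_epsO, hsubCObj_lamO, zero_add,
    hsubCObj_vr_self, Tm.enc_rename_of_below ht, h₁, h₂]
  simp [Fm.enc, Tm.enc]

theorem hsubFam_T_enc {M : CObj names} {ρ₀ : STy names} (hF : F.Below 0) :
    HSubFam M 0 ρ₀ (T (F.enc fun p => e p + 1)) τ ↔ τ = T (F.enc e) := by
  have : (F.enc fun p => e p + 1) = (F.enc e).up 1 := (F.enc_rename_of_below hF _ e).symm
  rw [this, hsubFam_T_up le_rfl, CObj.up_zero]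

end Lam

end FPST

namespace FPST

open CLLFP

/-! ### Typing rules for the constants -/

section Rules

variable {I : Interp names} {S : Sig names} {Γ : Ctx names}

theorem check_vr {i : ℕ} {a : FamName} (hΓ : ValidCtx I S Γ)
    (h : Γ[i]? = some (.atom (.con a))) : Check I S Γ (vr i) (.atom (.con a)) :=
  check_var hΓ h rfl

theorem validFam_app {a : FamName} {C : CObj names} (hΓ : ValidCtx I S Γ)
    (ha : Decl.fam a (.pi o .type) ∈ S) (hC : Check I S Γ C o) :
    ValidFam I S Γ (.atom (.app (.con a) C)) :=
  .atom (.app (.con hΓ ha) hC .type)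

theorem check_impO {A B : CObj names} (hΓ : ValidCtx I S Γ)
    (h : Decl.obj ObjName.imp (o.arrow (o.arrow o)) ∈ S) (hA : Check I S Γ A o)
    (hB : Check I S Γ B o) : Check I S Γ (impO A B) o :=
  .atom (.app (.app (.con hΓ h) hA (.pi (hsubFam_o.2 rfl) (hsubFam_o.2 rfl))) hB
    (hsubFam_o.2 rfl))

theorem check_epsO {t s : CObj names} (hΓ : ValidCtx I S Γ)
    (h : Decl.obj ObjName.eps (ind.arrow (ind.arrow o)) ∈ S) (ht : Check I S Γ t ind)
    (hs : Check I S Γ s ind) : Check I S Γ (epsO t s) o :=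
  .atom (.app (.app (.con hΓ h) ht (.pi (hsubFam_ind.2 rfl) (hsubFam_o.2 rfl))) hs
    (hsubFam_o.2 rfl))

theorem check_lamO {A : CObj names} (hΓ : ValidCtx I S Γ)
    (h : Decl.obj ObjName.lam ((ind.arrow o).arrow ind) ∈ S)
    (hA : Check I S (ind :: Γ) A o) : Check I S Γ (lamO (.lam ind A)) ind :=
  .atom (.app (.con hΓ h) (.lam hA) (hsubFam_ind.2 rfl))

theorem check_app_vr {i : ℕ} {t : CObj names} (hΓ : ValidCtx I S Γ)
    (h : Γ[i]? = some (ind.arrow o)) (ht : Check I S Γ t ind) :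
    Check I S Γ (.atom (.app (.var i) t)) o :=
  .atom (.app (.var hΓ h) ht (hsubFam_o.2 rfl))

theorem check_pairO {σ τ : Fam names} {x y : CObj names}
    (hΓ : ValidCtx I S (σ.arrow (τ.arrow o) :: Γ))
    (hx : Check I S (σ.arrow (τ.arrow o) :: Γ) x.shift σ.shift)
    (hy : Check I S (σ.arrow (τ.arrow o) :: Γ) y.shift τ.shift) :
    Check I S Γ (pairO σ τ x y) (prodF σ τ) := by
  have hu : Synth I S (σ.arrow (τ.arrow o) :: Γ) (.var 0)
      (.pi σ.shift (.pi (τ.shift.rename (skipRen 0)) o)) := by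
    have := Synth.var (i := 0) hΓ rfl
    simp only [Fam.arrow, Fam.rename, AFam.rename, Fam.shift, Fam.rename_rename,
      skipRen_zero] at this ⊢
    exact this
  exact .lam (.atom (.app (.app hu hx (.pi ((hsubFam_skipRen _).2 rfl) (hsubFam_o.2 rfl)))
    hy (hsubFam_o.2 rfl)))

end Rules

/-! ### The signature is valid -/

section Signature

variable {I : Interp names}

theorem validSig_sig : ValidSig I sig := by
  have h₁ : ValidSig I (sig.drop 11) := .kind .empty (.type (.empty .empty)) (by simp)
  have h₂ : ValidSig I (sig.drop 10) := .kind h₁ (.type (.empty h₁)) (by simp)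
  have hto : ∀ {S : Sig names}, ValidSig I S → Decl.fam FamName.o .type ∈ S →
      ValidKnd I S [] (.pi o .type) := fun hS h =>
    .pi (.type (.type (.empty hS) (validFam_con (.empty hS) h)))
  have h₃ : ValidSig I (sig.drop 9) := .kind h₂ (hto h₂ (by simp)) (by simp)
  have h₄ : ValidSig I (sig.drop 8) := .kind h₃ (hto h₃ (by simp)) (by simp)
  have hio : ∀ {S : Sig names} {Γ : Ctx names}, ValidCtx I S Γ →
      Decl.fam FamName.o .type ∈ S → Decl.fam FamName.ind .type ∈ S →
      ValidFam I S Γ (.pi ind o) := fun hΓ ho hi =>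
    .pi (validFam_con (.type hΓ (validFam_con hΓ hi)) ho)
  have h₅ : ValidSig I (sig.drop 7) := by
    refine .type h₄ (.pi (validFam_con (.type (.empty h₄) ?_) ?_)) ?_
    · exact hio (.empty h₄) (by simp) (by simp)
    · simp
    · simp
  have h₆ : ValidSig I (sig.drop 6) := by
    have hi := validFam_con (a := FamName.ind) (.empty h₅) (by simp [sig])
    exact .type h₅ (.pi (hio (.type (.empty h₅) hi) (by simp) (by simp)))
      (by simp)
  have h₇ : ValidSig I (sig.drop 5) := by
    have c₁ := ValidCtx.type (.empty h₆) (validFam_con (a := FamName.o) (.empty h₆)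
      (by simp [sig]))
    have c₂ := ValidCtx.type c₁ (validFam_con (a := FamName.o) c₁ (by simp [sig]))
    exact .type h₆ (.pi (.pi (validFam_con c₂ (by simp)))) (by simp)
  have h₈ : ValidSig I (sig.drop 4) := by
    have c₁ := ValidCtx.type (.empty h₇) (validFam_con (a := FamName.o) (.empty h₇)
      (by simp [sig]))
    have c₂ := ValidCtx.type c₁ (validFam_app (a := FamName.V) c₁ (by simp [sig])
      (check_vr (i := 0) c₁ rfl))
    exact .type h₇ (.pi (.pi (validFam_app c₂ (by simp) (check_vr (i := 1) c₂ rfl))))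
      (by simp)
  have hind : ∀ {S : Sig names} {Γ : Ctx names}, ValidCtx I S Γ →
      Decl.fam FamName.ind .type ∈ S → ValidCtx I S (ind :: Γ) :=
    fun hΓ hi => .type hΓ (validFam_con hΓ hi)
  have heps : ∀ {S : Sig names} {Γ : Ctx names} {i j : ℕ}, ValidCtx I S Γ →
      Decl.fam FamName.ind .type ∈ S →
      Decl.obj ObjName.eps (ind.arrow (ind.arrow o)) ∈ S →
      Decl.obj ObjName.lam ((ind.arrow o).arrow ind) ∈ S →
      Γ[i]? = some ind → Γ[j]? = some (ind.arrow o) →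
      Check I S Γ (epsO (vr i) (lamO (.lam ind (.atom (.app (.var (j + 1)) (vr 0)))))) o :=
    fun hΓ hi he hl h₁ h₂ => check_epsO hΓ he (check_vr hΓ h₁)
      (check_lamO hΓ hl (check_app_vr (hind hΓ hi) (by simpa using h₂)
        (check_vr (i := 0) (hind hΓ hi) rfl)))
  have h₉ : ValidSig I (sig.drop 3) := by
    have c₁ := ValidCtx.type (.empty h₈) (hio (.empty h₈) (by simp [sig]) (by simp [sig]))
    have c₂ := hind c₁ (by simp [sig])
    have c₃ := ValidCtx.type c₂ (validFam_app (a := FamName.T) c₂ (by simp [sig])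
      (check_app_vr (i := 1) c₂ rfl (check_vr (i := 0) c₂ rfl)))
    refine .type h₈ (.pi (.pi (.pi (validFam_app c₃ ?_
      (heps (i := 1) (j := 2) c₃ ?_ ?_ ?_ rfl rfl))))) ?_
    all_goals simp
  have h₁₀ : ValidSig I (sig.drop 2) := by
    have c₁ := ValidCtx.type (.empty h₉) (hio (.empty h₉) (by simp [sig]) (by simp [sig]))
    have c₂ := hind c₁ (by simp [sig])
    have c₃ := ValidCtx.type c₂ (validFam_app (a := FamName.T) c₂ (by simp [sig])
      (heps (i := 0) (j := 1) c₂ (by simp [sig]) (by simp [sig]) (by simp [sig]) rfl rfl))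
    refine .type h₉ (.pi (.pi (.pi (validFam_app c₃ ?_
      (check_app_vr (i := 2) c₃ rfl (check_vr (i := 1) c₃ rfl)))))) ?_
    all_goals simp
  have h₁₁ : ValidSig I (sig.drop 1) := by
    have c₁ := ValidCtx.type (.empty h₁₀) (validFam_con (a := FamName.o) (.empty h₁₀)
      (by simp [sig]))
    have c₂ := ValidCtx.type c₁ (validFam_con (a := FamName.o) c₁ (by simp [sig]))
    have c₃ := ValidCtx.type c₂ (validFam_app (a := FamName.V) c₂ (by simp [sig])
      (check_vr (i := 1) c₂ rfl))
    have c₄ := ValidCtx.type c₂ (.pi (validFam_app (a := FamName.T) c₃ (by simp [sig])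
      (check_vr (i := 1) c₃ rfl)))
    refine .type h₁₀ (.pi (.pi (.pi (validFam_app c₄ ?_ (check_impO c₄ ?_
      (check_vr (i := 2) c₄ rfl) (check_vr (i := 1) c₄ rfl)))))) ?_
    all_goals simp
  have c₁ := ValidCtx.type (.empty h₁₁) (validFam_con (a := FamName.o) (.empty h₁₁)
    (by simp [sig]))
  have c₂ := ValidCtx.type c₁ (validFam_con (a := FamName.o) c₁ (by simp [sig]))
  have hT : ∀ {i : ℕ} {Γ : Ctx names}, ValidCtx I (sig.drop 1) Γ → Γ[i]? = some o →
      ValidFam I (sig.drop 1) Γ (T (vr i)) := fun hΓ h =>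
    validFam_app hΓ (by simp [sig]) (check_vr hΓ h)
  have hTi : ∀ {i j : ℕ} {Γ : Ctx names}, ValidCtx I (sig.drop 1) Γ → Γ[i]? = some o →
      Γ[j]? = some o → ValidFam I (sig.drop 1) Γ (T (impO (vr i) (vr j))) := fun hΓ h h' =>
    validFam_app hΓ (by simp [sig]) (check_impO hΓ (by simp [sig]) (check_vr hΓ h)
      (check_vr hΓ h'))
  have c₃ := ValidCtx.type c₂ (hT (i := 1) c₂ rfl)
  have c₄ := ValidCtx.type c₃ (hTi (i := 2) (j := 1) c₃ rfl rfl)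
  have c₅ := ValidCtx.type c₄ (hT (i := 3) c₄ rfl)
  have c₆ := ValidCtx.type c₅ (hTi (i := 4) (j := 3) c₅ rfl rfl)
  have c₇ := ValidCtx.type c₄ (.pi (.pi (validFam_con (a := FamName.o) c₆ (by simp [sig]))))
  refine .type h₁₁ (.pi (.pi (.pi (.pi (.lock (hT (i := 2) c₄ rfl) ?_))))) (by simp)
  exact check_pairO c₇ (check_var (i := 2) c₇ rfl rfl) (check_var (i := 1) c₇ rfl rfl)

end Signature

/-! ### Typing of encodings and of inferences -/

section Encoding

variable {I : Interp names} {Γ : Ctx names}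

theorem validCtx_ind (hΓ : ValidCtx I sig Γ) : ValidCtx I sig (ind :: Γ) :=
  .type hΓ (validFam_con hΓ (by simp [sig]))

theorem validFam_T {C : CObj names} (hΓ : ValidCtx I sig Γ) (hC : Check I sig Γ C o) :
    ValidFam I sig Γ (T C) :=
  validFam_app hΓ (by simp [sig]) hC

theorem validFam_V {C : CObj names} (hΓ : ValidCtx I sig Γ) (hC : Check I sig Γ C o) :
    ValidFam I sig Γ (V C) :=
  validFam_app hΓ (by simp [sig]) hC

mutual

theorem check_tm_enc {As : List ℕ} {I : Interp names} :
    ∀ (t : Tm) {k : ℕ} {Γ : Ctx names} {e : ℕ → ℕ}, t.Good As k → ValidCtx I sig Γ →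
      (∀ i < k, Γ[i]? = some ind) → (∀ p ∈ As, Γ[e p]? = some o) →
      Check I sig Γ (t.enc e) ind
  | .var i, _, _, _, ht, hΓ, hi, _ => check_vr hΓ (hi i (Tm.good_var.1 ht))
  | .set A, _, _, _, ht, hΓ, hi, he =>
      check_lamO hΓ (by simp [sig]) (check_fm_enc A (Tm.good_set.1 ht) (validCtx_ind hΓ)
        (by
          rintro (_ | i) h
          · rfl
          · exact hi i (by omega))
        he)

theorem check_fm_enc {As : List ℕ} {I : Interp names} :
    ∀ (A : Fm) {k : ℕ} {Γ : Ctx names} {e : ℕ → ℕ}, A.Good As k → ValidCtx I sig Γ →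
      (∀ i < k, Γ[i]? = some ind) → (∀ p ∈ As, Γ[e p]? = some o) →
      Check I sig Γ (A.enc e) o
  | .letter p, _, _, _, hA, hΓ, _, he => check_vr hΓ (he p (Fm.good_letter.1 hA))
  | .mem t s, _, _, _, hA, hΓ, hi, he =>
      check_epsO hΓ (by simp [sig]) (check_tm_enc t (Fm.good_mem.1 hA).1 hΓ hi he)
        (check_tm_enc s (Fm.good_mem.1 hA).2 hΓ hi he)
  | .imp A B, _, _, _, hA, hΓ, hi, he =>
      check_impO hΓ (by simp [sig]) (check_fm_enc A (Fm.good_imp.1 hA).1 hΓ hi he)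
        (check_fm_enc B (Fm.good_imp.1 hA).2 hΓ hi he)

end

theorem check_delta {C v : CObj names} (hΓ : ValidCtx I sig Γ) (hC : Check I sig Γ C o)
    (hv : Check I sig Γ v (V C)) :
    Check I sig Γ (.atom (.app (.app (.con ObjName.delta) C) v)) (T C) := by
  refine .atom (.app (.app (.con hΓ (?_ : Decl.obj _ (.pi o (.pi (V (vr 0)) (T (vr 1)))) ∈ _))
    hC (hsubFam_delta.2 rfl)) hv ((hsubFam_T_up le_rfl).2 (by rw [CObj.up_zero])))
  simp [sig, Fam.rename, AFam.rename, CObj.rename, AObj.rename]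

theorem check_impIntro {A B M : CObj names} (hΓ : ValidCtx I sig Γ) (hA : Check I sig Γ A o)
    (hB : Check I sig Γ B o) (hM : Check I sig (V A :: Γ) M (T B.shift)) :
    Check I sig Γ (.atom (.app (.app (.app (.con ObjName.impIntro) A) B) (.lam (V A) M)))
      (T (impO A B)) := by
  refine .atom (.app (.app (.app (.con hΓ (?_ : Decl.obj _ (.pi o (.pi o
    (.pi (.pi (V (vr 1)) (T (vr 1))) (T (impO (vr 2) (vr 1)))))) ∈ _))
    hA (hsubFam_impIntro₁.2 rfl)) hB (hsubFam_impIntro₂.2 rfl)) (.lam hM)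
    ((hsubFam_T_impO_up le_rfl le_rfl).2 (by simp only [CObj.up_zero])))
  simp [sig, Fam.rename, AFam.rename, CObj.rename, AObj.rename, liftRen]

theorem synth_impElim {A B x y : CObj names} (hΓ : ValidCtx I sig Γ) (hA : Check I sig Γ A o)
    (hB : Check I sig Γ B o) (hx : Check I sig Γ x (T A))
    (hy : Check I sig Γ y (T (impO A B))) :
    Synth I sig Γ (.app (.app (.app (.app (.con ObjName.impElim) A) B) x) y)
      (fitchLock A B x y) := by
  refine .app (.app (.app (.app (.con hΓ (?_ : Decl.obj _ (.pi o (.pi o (.pi (T (vr 1))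
    (.pi (T (impO (vr 2) (vr 1))) (fitchLock (vr 3) (vr 2) (vr 1) (vr 0)))))) ∈ _))
    hA (hsubFam_impElim₁.2 rfl)) hB (hsubFam_impElim₂.2 rfl)) hx (hsubFam_impElim₃.2 rfl))
    hy (hsubFam_impElim₄.2 rfl)
  simp [sig]

theorem check_lamIntro {F : Fm} {t : Tm} {e : ℕ → ℕ} {M : CObj names}
    (hΓ : ValidCtx I sig Γ) (hF : F.Below 1) (ht : t.Below 0)
    (hA : Check I sig (ind :: Γ) (F.enc fun p => e p + 1) o) (hx : Check I sig Γ (t.enc e) ind)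
    (hM : Check I sig Γ M (T ((F.inst t).enc e))) :
    Check I sig Γ (.atom (.app (.app (.app (.con ObjName.lamIntro) (encLam e F)) (t.enc e)) M))
      (T ((Fm.mem t (.set F)).enc e)) := by
  refine .atom (.app (.app (.app (.con hΓ (?_ : Decl.obj _ (.pi (.pi ind o) (.pi ind
    (.pi (T (.atom (.app (.var 1) (vr 0))))
      (T (epsO (vr 1) (lamO (.lam ind (.atom (.app (.var 3) (vr 0)))))))))) ∈ _))
    (.lam hA) ((hsubFam_lamIntro₁ hF).2 rfl)) hx ((hsubFam_lamIntro₂ hF ht).2 rfl)) hM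
    ((hsubFam_T_enc (F := Fm.mem t (.set F)) ⟨ht, hF⟩).2 rfl))
  simp [sig, Fam.rename, AFam.rename, CObj.rename, AObj.rename, liftRen]

theorem check_lamElim {F : Fm} {t : Tm} {e : ℕ → ℕ} {M : CObj names}
    (hΓ : ValidCtx I sig Γ) (hF : F.Below 1) (ht : t.Below 0) (hFt : (F.inst t).Below 0)
    (hA : Check I sig (ind :: Γ) (F.enc fun p => e p + 1) o) (hx : Check I sig Γ (t.enc e) ind)
    (hM : Check I sig Γ M (T ((Fm.mem t (.set F)).enc e))) :
    Check I sig Γ (.atom (.app (.app (.app (.con ObjName.lamElim) (encLam e F)) (t.enc e)) M))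
      (T ((F.inst t).enc e)) := by
  refine .atom (.app (.app (.app (.con hΓ (?_ : Decl.obj _ (.pi (.pi ind o) (.pi ind
    (.pi (T (epsO (vr 0) (lamO (.lam ind (.atom (.app (.var 2) (vr 0)))))))
      (T (.atom (.app (.var 2) (vr 1))))))) ∈ _))
    (.lam hA) ((hsubFam_lamElim₁ hF).2 rfl)) hx ((hsubFam_lamElim₂ hF ht).2 rfl)) hM
    ((hsubFam_T_enc hFt).2 rfl))
  simp [sig, Fam.rename, AFam.rename, CObj.rename, AObj.rename, liftRen]

end Encoding

end FPST

namespace FPST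

open CLLFP

/-! ### The context of an encoded sequent -/

/-- The number of the variable that encodes a letter in front of `m` assumptions. -/
def letterVar (As : List ℕ) (m p : ℕ) : ℕ := m + As.idxOf p

theorem encIn_eq (As : List ℕ) (m : ℕ) (A : Fm) : A.encIn As m = A.enc (letterVar As m) := rfl

theorem letterVar_inj {As : List ℕ} {m : ℕ} :
    ∀ p ∈ As, ∀ q ∈ As, letterVar As m p = letterVar As m q → p = q := by
  intro p hp q hq h
  exact (List.idxOf_inj hp).1 (Nat.add_left_cancel h)

theorem encCtx_letter {As : List ℕ} {p : ℕ} (hp : p ∈ As) :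
    ∀ Γ : List Fm, (encCtx As Γ)[letterVar As Γ.length p]? = some o
  | [] => by
      have : As.idxOf p < As.length := List.idxOf_lt_length_iff.2 hp
      simp [letterVar, encCtx, this]
  | B :: Γ => by
      have := encCtx_letter hp Γ
      simp only [letterVar, List.length_cons, encCtx] at this ⊢
      rw [show Γ.length + 1 + As.idxOf p = (Γ.length + As.idxOf p) + 1 by omega,
        List.getElem?_cons_succ, this]

theorem encIn_rename_add {As : List ℕ} {m n l : ℕ} {B : Fm} (hB : B.Below 0)
    (h : m + n = l) : (B.encIn As m).rename (· + n) = B.encIn As l := by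
  subst h
  rw [encIn_eq, Fm.enc_rename_of_below hB, encIn_eq]
  congr 1
  funext p
  simp only [letterVar]; omega

/-- An entry of the context is the type of an encoded assumption, or `o`. -/
theorem encCtx_getElem {As : List ℕ} {σ : Fam names} :
    ∀ {Γ : List Fm} {i : ℕ}, (∀ B ∈ Γ, B.Good As 0) → (encCtx As Γ)[i]? = some σ →
      (∃ B, Γ[i]? = some B ∧ σ.rename (· + (i + 1)) = V (B.encIn As Γ.length)) ∨
        σ = o ∧ ∃ j, j < As.length ∧ i = Γ.length + j
  | [], i, _, h => by
      simp only [encCtx, List.getElem?_map, Option.map_eq_some_iff] at h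
      obtain ⟨p, hp, rfl⟩ := h
      exact .inr ⟨rfl, i, (List.getElem?_eq_some_iff.1 hp).1, by simp⟩
  | B :: Γ, 0, hΓ, h => by
      simp only [encCtx, List.getElem?_cons_zero, Option.some.injEq] at h
      subst h
      refine .inl ⟨B, rfl, ?_⟩
      simp [Fam.rename, AFam.rename, encIn_rename_add (n := 1) (hΓ B (by simp)).1 rfl]
  | B :: Γ, i + 1, hΓ, h => by
      rw [encCtx, List.getElem?_cons_succ] at h
      rcases encCtx_getElem (fun C hC => hΓ C (List.mem_cons_of_mem _ hC)) h with
        ⟨C, hC, hσ⟩ | ⟨rfl, j, hj, rfl⟩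
      · refine .inl ⟨C, by simpa using hC, ?_⟩
        have hC' := hΓ C (List.mem_cons_of_mem _ (List.mem_of_getElem? hC))
        have := congrArg (Fam.rename (· + 1)) hσ
        simp only [Fam.rename, AFam.rename, encIn_rename_add (n := 1) hC'.1 rfl,
          Fam.rename_rename] at this
        exact this
      · exact .inr ⟨rfl, j, hj, by simp; omega⟩

theorem encCtx_types {As : List ℕ} {τ : Fam names} :
    ∀ {Γ : List Fm}, τ ∈ encCtx As Γ → τ = o ∨ ∃ E, τ = V E
  | [], h => by
      simp only [encCtx, List.mem_map] at h
      obtain ⟨_, _, rfl⟩ := h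
      exact .inl rfl
  | B :: Γ, h => by
      rcases List.mem_cons.1 h with rfl | h
      · exact .inr ⟨_, rfl⟩
      · exact encCtx_types h

theorem validCtx_encCtx {I : Interp names} {As : List ℕ} :
    ∀ {Γ : List Fm}, (∀ B ∈ Γ, B.Good As 0) → ValidCtx I sig (encCtx As Γ)
  | [], _ => by
      have : ∀ l : List ℕ, ValidCtx I sig (l.map fun _ => o) := by
        intro l
        induction l with
        | nil => exact .empty validSig_sig
        | cons _ l ih => exact .type ih (validFam_con ih (by simp [sig]))
      exact this As
  | B :: Γ, hΓ => by
      have h := validCtx_encCtx (I := I) fun C hC => hΓ C (List.mem_cons_of_mem _ hC)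
      exact .type h (validFam_V h (check_fm_enc B (hΓ B (by simp)) h (by simp)
        fun p hp => encCtx_letter hp Γ))

/-- `ξ` maps the variables of `encCtx As Γ` to variables of `Γ'` of the corresponding types. -/
structure CtxMap (As : List ℕ) (Γ : List Fm) (Γ' : Ctx names) (ξ : ℕ → ℕ) : Prop where
  letter : ∀ p ∈ As, Γ'[ξ (letterVar As Γ.length p)]? = some o
  hyp : ∀ i B, Γ[i]? = some B → ∃ σ, Γ'[ξ i]? = some σ ∧
    σ.rename (· + (ξ i + 1)) = V (B.enc fun p => ξ (letterVar As Γ.length p))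

theorem CtxMap.id {As : List ℕ} {Γ : List Fm} (hΓ : ∀ B ∈ Γ, B.Good As 0) :
    CtxMap As Γ (encCtx As Γ) id where
  letter p hp := encCtx_letter hp Γ
  hyp i B hB := by
    have hi : i < (encCtx As Γ).length := by
      have : Γ.length ≤ (encCtx As Γ).length := by
        clear hB hΓ
        induction Γ with
        | nil => simp
        | cons B Γ ih => simpa [encCtx] using ih
      exact lt_of_lt_of_le (List.getElem?_eq_some_iff.1 hB).1 this
    refine ⟨_, List.getElem?_eq_getElem hi, ?_⟩
    rcases encCtx_getElem hΓ (List.getElem?_eq_getElem hi) with ⟨C, hC, hσ⟩ | ⟨_, j, _, rfl⟩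
    · rw [hB] at hC
      cases hC
      exact hσ
    · have := (List.getElem?_eq_some_iff.1 hB).1
      omega

theorem CtxMap.weaken {As : List ℕ} {Γ : List Fm} {Γ' : Ctx names} {ξ : ℕ → ℕ}
    (h : CtxMap As Γ Γ' ξ) (hΓ : ∀ B ∈ Γ, B.Good As 0) (τ : Fam names) :
    CtxMap As Γ (τ :: Γ') (Nat.succ ∘ ξ) where
  letter p hp := by simpa using h.letter p hp
  hyp i B hB := by
    obtain ⟨σ, hσ, hσ'⟩ := h.hyp i B hB
    refine ⟨σ, by simpa using hσ, ?_⟩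
    have := congrArg (Fam.rename Nat.succ) hσ'
    simp only [Fam.rename, AFam.rename, Fam.rename_rename,
      Fm.enc_rename_of_below (hΓ B (List.mem_of_getElem? hB)).1] at this
    exact this

theorem CtxMap.lift {As : List ℕ} {Γ : List Fm} {Γ' : Ctx names} {ξ : ℕ → ℕ}
    (h : CtxMap As Γ Γ' ξ) (hΓ : ∀ B ∈ Γ, B.Good As 0) {A : Fm} (hA : A.Below 0) :
    CtxMap As (A :: Γ) (V (A.enc fun p => ξ (letterVar As Γ.length p)) :: Γ') (liftRen ξ) := by
  have hl : ∀ p, liftRen ξ (letterVar As (Γ.length + 1) p) =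
      ξ (letterVar As Γ.length p) + 1 := by
    intro p
    simp only [letterVar]
    rw [show Γ.length + 1 + As.idxOf p = Γ.length + As.idxOf p + 1 by omega]
    rfl
  have h' := h.weaken hΓ (V (A.enc fun p => ξ (letterVar As Γ.length p)))
  refine ⟨fun p hp => ?_, ?_⟩
  · rw [List.length_cons, hl]
    exact h'.letter p hp
  · simp only [List.length_cons, hl]
    rintro (_ | i) B hB
    · cases hB
      refine ⟨_, rfl, ?_⟩
      simp only [Fam.rename, AFam.rename, Fm.enc_rename_of_below hA]
      rfl
    · exact h'.hyp i B hB

/-! ### Objects of deductions -/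

theorem Prf.Normal.normalizable {p : Prf} (h : p.Normal) : p.Normalizable := ⟨p, .refl, h⟩

/-- The interpretation for which the locks are not checked. -/
abbrev trivialInterp : Interp names := fun _ _ _ _ _ => True

theorem shift_rename_liftRen (M : CObj names) (ξ : ℕ → ℕ) :
    M.shift.rename (liftRen ξ) = (M.rename ξ).shift := by
  rw [CObj.shift, CObj.shift, CObj.rename_rename, CObj.rename_rename]; rfl

theorem rename_pairO (A B x y : CObj names) (ξ : ℕ → ℕ) :
    (pairO (T A) (T B) x y).rename ξ =
      pairO (T (A.rename ξ)) (T (B.rename ξ)) (x.rename ξ) (y.rename ξ) := by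
  simp only [pairO, Fam.arrow, CObj.rename, AObj.rename, Fam.rename, AFam.rename, Fam.shift,
    shift_rename_liftRen, liftRen]

theorem rename_prodF (A B : CObj names) (ξ : ℕ → ℕ) :
    (prodF (T A) (T B)).rename ξ = prodF (T (A.rename ξ)) (T (B.rename ξ)) := by
  simp only [prodF, Fam.arrow, Fam.rename, AFam.rename, Fam.shift, shift_rename_liftRen]

theorem rename_impElim (A B C D x y x' y' : CObj names) (ξ : ℕ → ℕ) :
    (CObj.atom (.unlock PredName.fitch (pairO (T A) (T B) x y) (prodF (T A) (T B))
      (.app (.app (.app (.app (.con ObjName.impElim) C) D) x') y')) : CObj names).rename ξ =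
      .atom (.unlock PredName.fitch
        (pairO (T (A.rename ξ)) (T (B.rename ξ)) (x.rename ξ) (y.rename ξ))
        (prodF (T (A.rename ξ)) (T (B.rename ξ)))
        (.app (.app (.app (.app (.con ObjName.impElim) (C.rename ξ)) (D.rename ξ))
          (x'.rename ξ)) (y'.rename ξ))) := by
  rw [← rename_pairO, ← rename_prodF]; rfl

theorem validCtx_arrow {I : Interp names} {As : List ℕ} {Γ : Ctx names} {e : ℕ → ℕ}
    {A B : Fm} (hΓ : ValidCtx I sig Γ) (he : ∀ p ∈ As, Γ[e p]? = some o) (hA : A.Good As 0)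
    (hB : B.Good As 0) :
    ValidCtx I sig ((T (A.enc e)).arrow ((T (B.enc e)).arrow o) :: Γ) := by
  have c₁ := ValidCtx.type hΓ (validFam_T hΓ (check_fm_enc A hA hΓ (by simp) he))
  have c₂ := ValidCtx.type c₁ (validFam_T c₁ (check_fm_enc (e := fun p => Nat.succ (e p)) B hB c₁
    (by simp) (by simpa using he)))
  refine .type hΓ (.pi (.pi (?_ : ValidFam _ _ _ o)))
  rw [← Fm.enc_rename_of_below hB.1] at c₂
  exact validFam_con c₂ (by simp [sig])

theorem Quasi.exists_obj {As : List ℕ} {Γ : List Fm} {p : Prf} {A : Fm} (h : Quasi Γ p A) :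
    p.Normal →
    ∃ M : CObj names, ProofOf M p ∧ ∀ I, (I = trivialInterp ∨ I = fitch) →
      ∀ (Γ' : Ctx names) (ξ : ℕ → ℕ), ValidCtx I sig Γ' →
        CtxMap As (Γ.map (Fm.clean As 0)) Γ' ξ →
        Check I sig Γ' (M.rename ξ)
          (T ((A.clean As 0).enc fun p => ξ (letterVar As Γ.length p))) := by
  have hclean : ∀ Γ : List Fm, ∀ B ∈ Γ.map (Fm.clean As 0), B.Good As 0 := by
    intro Γ B hB
    obtain ⟨C, -, rfl⟩ := List.mem_map.1 hB
    exact Fm.clean_good 0 C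
  induction h with
  | @hyp Γ i A h =>
    intro _
    refine ⟨_, .delta (A := (A.clean As 0).encIn As Γ.length), ?_⟩
    intro I _ Γ' ξ hΓ' hξ
    have he := hξ.letter
    rw [List.length_map] at he
    obtain ⟨σ, hσ, hσ'⟩ := hξ.hyp i (A.clean As 0) (by simp [h])
    rw [List.length_map] at hσ'
    have hA := Fm.clean_good (As := As) 0 A
    simp only [CObj.rename, AObj.rename, encIn_eq, Fm.enc_rename_of_below hA.1]
    exact check_delta hΓ' (check_fm_enc _ hA hΓ' (by simp) he) (check_var hΓ' hσ hσ')
  | @impI Γ p A B _ ih =>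
    intro hp
    obtain ⟨M, hM, ih⟩ := ih fun q hq => hp _ (.impI hq)
    refine ⟨_, .impIntro (A := (A.clean As 0).encIn As Γ.length)
      (B := (B.clean As 0).encIn As Γ.length)
      (σ := V ((A.clean As 0).encIn As Γ.length)) hM, ?_⟩
    intro I hI Γ' ξ hΓ' hξ
    have he := hξ.letter
    rw [List.length_map] at he
    have hA := Fm.clean_good (As := As) 0 A
    have hB := Fm.clean_good (As := As) 0 B
    simp only [CObj.rename, AObj.rename, Fam.rename, AFam.rename, encIn_eq,
      Fm.enc_rename_of_below hA.1, Fm.enc_rename_of_below hB.1]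
    have hA' := check_fm_enc _ hA hΓ' (by simp) he
    have hl := hξ.lift (hclean Γ) hA.1
    rw [List.length_map] at hl
    refine check_impIntro hΓ' hA' (check_fm_enc _ hB hΓ' (by simp) he) ?_
    have := ih I hI _ _ (.type hΓ' (validFam_V hΓ' hA')) hl
    rw [CObj.shift, Fm.enc_rename_of_below hB.1]
    convert this using 4 with p
    simp only [List.length_cons, letterVar]
    rw [show Γ.length + 1 + As.idxOf p = Γ.length + As.idxOf p + 1 by omega]
    rfl
  | @impE Γ p q A B _ _ ih₁ ih₂ =>
    intro hpq
    obtain ⟨X, hX, ih₁⟩ := ih₁ fun q hq => hpq _ (.impE_left hq)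
    obtain ⟨Y, hY, ih₂⟩ := ih₂ fun q hq => hpq _ (.impE_right hq)
    have hA := Fm.clean_good (As := As) 0 A
    have hB := Fm.clean_good (As := As) 0 B
    have hAB := Fm.good_imp.2 ⟨hA, hB⟩
    set E : Fm → CObj names := fun F => F.enc (letterVar As Γ.length) with hE
    refine ⟨_, .impElim (A := E (A.clean As 0)) (B := E (B.clean As 0))
      (N := pairO (T (E (A.clean As 0))) (T (impO (E (A.clean As 0)) (E (B.clean As 0)))) X Y)
      (σ := prodF (T (E (A.clean As 0))) (T (impO (E (A.clean As 0)) (E (B.clean As 0)))))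
      hX hY, ?_⟩
    intro I hI Γ' ξ hΓ' hξ
    have he := hξ.letter
    rw [List.length_map] at he
    have himp : ∀ e, impO ((A.clean As 0).enc e) ((B.clean As 0).enc e) =
      (Fm.imp (A.clean As 0) (B.clean As 0)).enc e := fun _ => rfl
    simp only [hE, himp]
    simp only [rename_impElim, Fm.enc_rename_of_below hA.1, Fm.enc_rename_of_below hB.1,
      Fm.enc_rename_of_below hAB.1]
    have hU := validCtx_arrow hΓ' he hA hAB
    refine .atom (.unlock (synth_impElim hΓ' (check_fm_enc _ hA hΓ' (by simp) he)
      (check_fm_enc _ hB hΓ' (by simp) he) (ih₁ I hI Γ' ξ hΓ' hξ)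
      (ih₂ I hI Γ' ξ hΓ' hξ)) (check_pairO hU ?_ ?_) ?_)
    · have := ih₁ I hI _ _ hU (hξ.weaken (hclean Γ) _)
      simp only [CObj.shift, CObj.rename_rename, Fam.shift, Fam.rename, AFam.rename,
        Fm.enc_rename_of_below hA.1]
      exact this
    · have := ih₂ I hI _ _ hU (hξ.weaken (hclean Γ) _)
      simp only [CObj.shift, CObj.rename_rename, Fam.shift, Fam.rename, AFam.rename,
        Fm.enc_rename_of_below hAB.1]
      exact this
    · rcases hI with rfl | rfl
      · trivial
      · have hΔ := validCtx_encCtx (I := trivialInterp) (hclean Γ)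
        have hX' := ih₁ _ (.inl rfl) _ _ hΔ (.id (hclean Γ))
        have hY' := ih₂ _ (.inl rfl) _ _ hΔ (.id (hclean Γ))
        rw [CObj.rename_id] at hX' hY'
        exact ⟨_, _, _, _, rfl, rfl, _, _, _, X, Y, _, p, q, fun _ => encCtx_types, hX', hY',
          CObj.subst_var ξ X, CObj.subst_var ξ Y, hX, hY, hpq.normalizable⟩
  | @lamI Γ p A t _ ih =>
    intro hp
    obtain ⟨M, hM, ih⟩ := ih fun q hq => hp _ (.lamI hq)
    refine ⟨_, .lamIntro (A := encLam (letterVar As Γ.length) (A.clean As 1))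
      (t := (t.clean As 0).enc (letterVar As Γ.length)) hM, ?_⟩
    intro I hI Γ' ξ hΓ' hξ
    have he := hξ.letter
    rw [List.length_map] at he
    have hA := Fm.clean_good (As := As) 1 A
    have ht := Tm.clean_good (As := As) 0 t
    simp only [CObj.rename, AObj.rename, Fam.rename, AFam.rename,
      Fm.enc_rename_liftRen hA.1, Tm.enc_rename_of_below ht.1]
    refine check_lamIntro hΓ' hA.1 ht.1 (check_fm_enc _ hA (validCtx_ind hΓ') ?_ ?_)
      (check_tm_enc _ ht hΓ' (by simp) he) ?_
    · intro i hi; rw [Nat.lt_one_iff.1 hi]; rfl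
    · simpa using he
    · rw [← Fm.clean_inst]
      exact ih I hI Γ' ξ hΓ' hξ
  | @lamE Γ p A t _ ih =>
    intro hp
    obtain ⟨M, hM, ih⟩ := ih fun q hq => hp _ (.lamE hq)
    refine ⟨_, .lamElim (A := encLam (letterVar As Γ.length) (A.clean As 1))
      (t := (t.clean As 0).enc (letterVar As Γ.length)) hM, ?_⟩
    intro I hI Γ' ξ hΓ' hξ
    have he := hξ.letter
    rw [List.length_map] at he
    have hA := Fm.clean_good (As := As) 1 A
    have ht := Tm.clean_good (As := As) 0 t
    simp only [CObj.rename, AObj.rename, Fam.rename, AFam.rename,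
      Fm.enc_rename_liftRen hA.1, Tm.enc_rename_of_below ht.1]
    rw [Fm.clean_inst]
    refine check_lamElim hΓ' hA.1 ht.1 (hA.inst ht).1
      (check_fm_enc _ hA (validCtx_ind hΓ') ?_ ?_)
      (check_tm_enc _ ht hΓ' (by simp) he) (ih I hI Γ' ξ hΓ' hξ)
    · intro i hi; rw [Nat.lt_one_iff.1 hi]; rfl
    · simpa using he

theorem Provable.exists_obj {As : List ℕ} {Γ : List Fm} {A : Fm} (hΓ : ∀ B ∈ Γ, B.Good As 0)
    (hA : A.Good As 0) (h : Provable Γ A) :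
    ∃ M, NormalizableObj M ∧ Check fitch sig (encCtx As Γ) M (T (A.encIn As Γ.length)) := by
  obtain ⟨p, hp, q, hpq, hq⟩ := h
  obtain ⟨M, hM, h⟩ := Quasi.exists_obj (As := As) (hp.steps hpq) hq
  refine ⟨M, ⟨q, hM, hq.normalizable⟩, ?_⟩
  have hmap : Γ.map (Fm.clean As 0) = Γ :=
    (List.map_congr_left fun B hB => (hΓ B hB).clean_eq).trans (List.map_id Γ)
  have := h fitch (.inr rfl) _ _ (validCtx_encCtx hΓ) (by rw [hmap]; exact .id hΓ)
  rwa [CObj.rename_id, hA.clean_eq] at this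

end FPST

namespace FPST

open CLLFP

/-! ### Objects of type `o` and `ι` are encodings -/

/-- The entries of `Γ` are the type `ι` for the variables below `k`, the type `o` for the variables
that encode letters, and types `V(E)`. -/
def DecodableCtx (As : List ℕ) (k : ℕ) (e : ℕ → ℕ) (Γ : Ctx names) : Prop :=
  ∀ i σ, Γ[i]? = some σ →
    σ = ind ∧ i < k ∨ (σ = o ∧ ∃ p ∈ As, i = e p) ∨ ∃ E, σ = V E

theorem DecodableCtx.cons_ind {As : List ℕ} {k : ℕ} {e : ℕ → ℕ} {Γ : Ctx names}
    (h : DecodableCtx As k e Γ) : DecodableCtx As (k + 1) (fun p => e p + 1) (ind :: Γ) := by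
  rintro (_ | i) σ hσ
  · cases hσ
    exact .inl ⟨rfl, by simp⟩
  · simpa using h i σ hσ

theorem decodableCtx_encCtx {As : List ℕ} (hAs : As.Nodup) :
    ∀ {Γ : List Fm}, DecodableCtx As 0 (letterVar As Γ.length) (encCtx As Γ)
  | [], i, σ, hσ => by
      simp only [encCtx, List.getElem?_map, Option.map_eq_some_iff] at hσ
      obtain ⟨p, hp, rfl⟩ := hσ
      obtain ⟨hi, rfl⟩ := List.getElem?_eq_some_iff.1 hp
      exact .inr (.inl ⟨rfl, _, List.getElem_mem hi, by
        simp [letterVar, hAs.idxOf_getElem i hi]⟩)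
  | B :: Γ, 0, σ, hσ => by
      cases hσ
      exact .inr (.inr ⟨_, rfl⟩)
  | B :: Γ, i + 1, σ, hσ => by
      rcases decodableCtx_encCtx hAs i σ hσ with ⟨-, h⟩ | ⟨rfl, p, hp, rfl⟩ | h
      · omega
      · exact .inr (.inl ⟨rfl, p, hp, by simp only [letterVar, List.length_cons]; omega⟩)
      · exact .inr (.inr h)

/-- The atomic objects with a type that ends in `o` or `ι`. -/
inductive SynObj (As : List ℕ) (k : ℕ) (e : ℕ → ℕ) : AObj names → Fam names → Prop
  | fm {A : AObj names} {F : Fm} : F.Good As k → .atom A = F.enc e → SynObj As k e A o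
  | tm {A : AObj names} {t : Tm} : t.Good As k → .atom A = t.enc e → SynObj As k e A ind
  | lam : SynObj As k e (.con ObjName.lam) (.pi (.pi ind o) ind)
  | eps : SynObj As k e (.con ObjName.eps) (.pi ind (.pi ind o))
  | eps_app {t : Tm} : t.Good As k →
      SynObj As k e (.app (.con ObjName.eps) (t.enc e)) (.pi ind o)
  | imp : SynObj As k e (.con ObjName.imp) (.pi o (.pi o o))
  | imp_app {F : Fm} : F.Good As k →
      SynObj As k e (.app (.con ObjName.imp) (F.enc e)) (.pi o o)

section Decode

variable {I : Interp names} {As : List ℕ}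

mutual

theorem synth_decode : ∀ (A : AObj names) {k : ℕ} {e : ℕ → ℕ} {Γ : Ctx names} {τ : Fam names},
    DecodableCtx As k e Γ → Synth I sig Γ A τ →
      τ.head = FamName.o ∨ τ.head = FamName.ind → SynObj As k e A τ
  | .con c, k, e, Γ, τ, hΓ, h, hτ => by
      have := synth_con_inv h
      simp only [sig, List.mem_reverse, List.mem_cons, Decl.obj.injEq, reduceCtorEq,
        List.not_mem_nil, or_false, false_or] at this
      rcases this with ⟨rfl, rfl⟩ | ⟨rfl, rfl⟩ | ⟨rfl, rfl⟩ | ⟨rfl, rfl⟩ | ⟨rfl, rfl⟩ |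
        ⟨rfl, rfl⟩ | ⟨rfl, rfl⟩ | ⟨rfl, rfl⟩
      · exact .lam
      · exact .eps
      · exact .imp
      all_goals simp [Fam.head, AFam.head, Fam.rename, AFam.rename] at hτ
  | .var i, k, e, Γ, τ, hΓ, h, hτ => by
      obtain ⟨σ, hσ, rfl⟩ := synth_var_inv h
      rcases hΓ i σ hσ with ⟨rfl, hi⟩ | ⟨rfl, p, hp, rfl⟩ | ⟨E, rfl⟩
      · exact .tm (t := .var i) (Tm.good_var.2 hi) rfl
      · exact .fm (F := .letter p) (Fm.good_letter.2 hp) rfl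
      · simp [Fam.head, AFam.head, Fam.rename, AFam.rename] at hτ
  | .app A M, k, e, Γ, τ, hΓ, h, hτ => by
      obtain ⟨σ, τ₁, hA, hM, hτ₁⟩ := synth_app_inv h
      rw [hτ₁.head_eq] at hτ
      have hM := fun h => check_decode M (σ := σ) hΓ h
      cases synth_decode A hΓ hA hτ with
      | lam =>
        obtain ⟨F, hF, rfl⟩ := (hM ‹_›).2.2 rfl
        rw [hsubFam_ind] at hτ₁
        subst hτ₁
        exact .tm (t := .set F) hF rfl
      | eps =>
        obtain ⟨t, ht, rfl⟩ := (hM ‹_›).2.1 rfl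
        simp only [hsubFam_pi, hsubFam_ind, hsubFam_o] at hτ₁
        obtain ⟨_, _, rfl, rfl, rfl⟩ := hτ₁
        exact .eps_app ht
      | @eps_app s hs =>
        obtain ⟨t, ht, rfl⟩ := (hM ‹_›).2.1 rfl
        rw [hsubFam_o] at hτ₁
        subst hτ₁
        exact .fm (F := .mem s t) (Fm.good_mem.2 ⟨hs, ht⟩) rfl
      | imp =>
        obtain ⟨F, hF, rfl⟩ := (hM ‹_›).1 rfl
        simp only [hsubFam_pi, hsubFam_o] at hτ₁
        obtain ⟨_, _, rfl, rfl, rfl⟩ := hτ₁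
        exact .imp_app hF
      | @imp_app G hG =>
        obtain ⟨F, hF, rfl⟩ := (hM ‹_›).1 rfl
        rw [hsubFam_o] at hτ₁
        subst hτ₁
        exact .fm (F := .imp G F) (Fm.good_imp.2 ⟨hG, hF⟩) rfl
  | .unlock P N σ A, k, e, Γ, τ, hΓ, h, hτ => by
      cases synth_decode A hΓ (synth_unlock_inv h) hτ

theorem check_decode : ∀ (C : CObj names) {k : ℕ} {e : ℕ → ℕ} {Γ : Ctx names} {σ : Fam names},
    DecodableCtx As k e Γ → Check I sig Γ C σ →
      (σ = o → ∃ F : Fm, F.Good As k ∧ C = F.enc e) ∧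
      (σ = ind → ∃ t : Tm, t.Good As k ∧ C = t.enc e) ∧
      (σ = .pi ind o → ∃ F : Fm, F.Good As (k + 1) ∧ C = encLam e F)
  | .atom A, k, e, Γ, σ, hΓ, h => by
      have hA := check_atom_inv h
      refine ⟨?_, ?_, ?_⟩
      · rintro rfl
        cases synth_decode A hΓ hA (.inl rfl) with | fm hF h => exact ⟨_, hF, h⟩
      · rintro rfl
        cases synth_decode A hΓ hA (.inr rfl) with | tm ht h => exact ⟨_, ht, h⟩
      · rintro rfl
        cases h
  | .lam τ M, k, e, Γ, σ, hΓ, h => by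
      refine ⟨?_, ?_, ?_⟩
      · rintro rfl
        cases h
      · rintro rfl
        cases h
      · rintro rfl
        obtain ⟨rfl, hM⟩ := check_lam_inv h
        obtain ⟨F, hF, rfl⟩ := (check_decode M hΓ.cons_ind hM).1 rfl
        exact ⟨F, hF, rfl⟩
  | .lock P N τ M, k, e, Γ, σ, hΓ, h => by
      refine ⟨?_, ?_, ?_⟩ <;> rintro rfl <;> cases h

end

end Decode

/-! ### The deduction represented by an object -/

section Deduction

variable {I : Interp names} {Γ : Ctx names}

theorem synth_delta_inv {A : CObj names} {τ : Fam names}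
    (h : Synth I sig Γ (.app (.con ObjName.delta) A) τ) :
    Check I sig Γ A o ∧ τ = .pi (V A) (T (A.up 1)) := by
  obtain ⟨σ, τ₁, hc, hA, hs⟩ := synth_app_inv h
  have := synth_con_inv hc
  simp [sig, Fam.rename, AFam.rename] at this
  obtain ⟨rfl, rfl⟩ := this
  exact ⟨hA, hsubFam_delta.1 hs⟩

theorem synth_impIntro_inv {A B : CObj names} {τ : Fam names}
    (h : Synth I sig Γ (.app (.app (.con ObjName.impIntro) A) B) τ) :
    Check I sig Γ A o ∧ Check I sig Γ B o ∧
      τ = .pi (.pi (V A) (T (B.up 1))) (T (impO (A.up 1) (B.up 1))) := by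
  obtain ⟨σ, τ₁, h, hB, hs⟩ := synth_app_inv h
  obtain ⟨σ', τ₂, hc, hA, hs'⟩ := synth_app_inv h
  have := synth_con_inv hc
  simp [sig, Fam.rename, AFam.rename] at this
  obtain ⟨rfl, rfl⟩ := this
  cases hsubFam_impIntro₁.1 hs'
  exact ⟨hA, hB, hsubFam_impIntro₂.1 hs⟩

theorem synth_impElim_inv {A B x y : CObj names} {τ : Fam names}
    (h : Synth I sig Γ (.app (.app (.app (.app (.con ObjName.impElim) A) B) x) y) τ) :
    Check I sig Γ A o ∧ Check I sig Γ B o ∧ Check I sig Γ x (T A) ∧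
      Check I sig Γ y (T (impO A B)) ∧ τ = fitchLock A B x y := by
  obtain ⟨σ₄, τ₄, h, hy, hs₄⟩ := synth_app_inv h
  obtain ⟨σ₃, τ₃, h, hx, hs₃⟩ := synth_app_inv h
  obtain ⟨σ₂, τ₂, h, hB, hs₂⟩ := synth_app_inv h
  obtain ⟨σ₁, τ₁, hc, hA, hs₁⟩ := synth_app_inv h
  have : Decl.obj ObjName.impElim (.pi o (.pi o (.pi (T (vr 1)) (.pi (T (impO (vr 2) (vr 1)))
      (fitchLock (vr 3) (vr 2) (vr 1) (vr 0)))))) = Decl.obj ObjName.impElim (.pi σ₁ τ₁) := by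
    have := synth_con_inv hc
    simp only [sig, List.mem_reverse, List.mem_cons, Decl.obj.injEq, reduceCtorEq,
      List.not_mem_nil, or_false, false_or, false_and] at this
    rw [this.2]
  cases this
  cases hsubFam_impElim₁.1 hs₁
  cases hsubFam_impElim₂.1 hs₂
  cases hsubFam_impElim₃.1 hs₃
  exact ⟨hA, hB, hx, hy, hsubFam_impElim₄.1 hs₄⟩

theorem synth_lamIntro_inv {As : List ℕ} {e : ℕ → ℕ} (hΓ : DecodableCtx As 0 e Γ)
    {A t : CObj names} {τ : Fam names}
    (h : Synth I sig Γ (.app (.app (.con ObjName.lamIntro) A) t) τ) :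
    ∃ (F : Fm) (s : Tm), F.Good As 1 ∧ s.Good As 0 ∧
      τ = .pi (T ((F.inst s).enc e)) (T ((Fm.mem s (.set F)).enc fun p => e p + 1)) := by
  obtain ⟨σ, τ₁, h, ht, hs⟩ := synth_app_inv h
  obtain ⟨σ', τ₂, hc, hA, hs'⟩ := synth_app_inv h
  have := synth_con_inv hc
  simp [sig, Fam.rename, AFam.rename] at this
  obtain ⟨rfl, rfl⟩ := this
  obtain ⟨F, hF, rfl⟩ := (check_decode A hΓ hA).2.2 rfl
  cases (hsubFam_lamIntro₁ hF.1).1 hs'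
  obtain ⟨s, hs₀, rfl⟩ := (check_decode t hΓ ht).2.1 rfl
  exact ⟨F, s, hF, hs₀, (hsubFam_lamIntro₂ hF.1 hs₀.1).1 hs⟩

theorem synth_lamElim_inv {As : List ℕ} {e : ℕ → ℕ} (hΓ : DecodableCtx As 0 e Γ)
    {A t : CObj names} {τ : Fam names}
    (h : Synth I sig Γ (.app (.app (.con ObjName.lamElim) A) t) τ) :
    ∃ (F : Fm) (s : Tm), F.Good As 1 ∧ s.Good As 0 ∧
      τ = .pi (T ((Fm.mem s (.set F)).enc e)) (T ((F.inst s).enc fun p => e p + 1)) := by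
  obtain ⟨σ, τ₁, h, ht, hs⟩ := synth_app_inv h
  obtain ⟨σ', τ₂, hc, hA, hs'⟩ := synth_app_inv h
  have := synth_con_inv hc
  simp [sig, Fam.rename, AFam.rename] at this
  obtain ⟨rfl, rfl⟩ := this
  obtain ⟨F, hF, rfl⟩ := (check_decode A hΓ hA).2.2 rfl
  cases (hsubFam_lamElim₁ hF.1).1 hs'
  obtain ⟨s, hs₀, rfl⟩ := (check_decode t hΓ ht).2.1 rfl
  exact ⟨F, s, hF, hs₀, (hsubFam_lamElim₂ hF.1 hs₀.1).1 hs⟩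

theorem T_inj {A B : CObj names} (h : T A = T B) : A = B := by simpa using h

theorem ProofOf.quasi {As : List ℕ} (hAs : As.Nodup) {M : CObj names} {p : Prf}
    (h : ProofOf M p) :
    ∀ {Γ : List Fm} {F : Fm}, (∀ B ∈ Γ, B.Good As 0) → F.Good As 0 →
      Check I sig (encCtx As Γ) M (T (F.encIn As Γ.length)) → Quasi Γ p F := by
  have hinj : ∀ {m : ℕ} {F G : Fm}, F.Good As 0 → G.Good As 0 →
      F.encIn As m = G.encIn As m → F = G :=
    fun hF hG h => Fm.enc_inj letterVar_inj hF.2 hG.2 h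
  induction h with
  | @delta A i =>
    intro Γ F hΓ hF h
    obtain ⟨σ, τ, h, hv, hs⟩ := synth_app_inv (check_atom_inv h)
    obtain ⟨-, hτ⟩ := synth_delta_inv h
    cases hτ
    rw [hsubFam_T_up le_rfl, CObj.up_zero] at hs
    cases T_inj hs
    obtain ⟨σ, hi, hσ⟩ := synth_var_inv (check_atom_inv hv)
    rcases encCtx_getElem hΓ hi with ⟨B, hB, hσ'⟩ | ⟨rfl, -⟩
    · rw [hσ'] at hσ
      have : F = B := hinj hF (hΓ B (List.mem_of_getElem? hB)) (by simpa using hσ)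
      exact .hyp (this ▸ hB)
    · cases hσ
  | @impIntro A B σ M p _ ih =>
    intro Γ F hΓ hF h
    obtain ⟨σ, τ, h, hM, hs⟩ := synth_app_inv (check_atom_inv h)
    obtain ⟨cA, cB, hτ⟩ := synth_impIntro_inv h
    cases hτ
    have hdec := decodableCtx_encCtx hAs (Γ := Γ)
    obtain ⟨A, hA, rfl⟩ := (check_decode _ hdec cA).1 rfl
    obtain ⟨B, hB, rfl⟩ := (check_decode _ hdec cB).1 rfl
    rw [hsubFam_T_impO_up le_rfl le_rfl, CObj.up_zero, CObj.up_zero] at hs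
    have hAB := Fm.good_imp.2 ⟨hA, hB⟩
    cases hinj hF hAB (T_inj hs)
    obtain ⟨rfl, hM'⟩ := check_lam_inv hM
    refine .impI (ih (Γ := A :: Γ) ?_ hB ?_)
    · simpa [hA] using hΓ
    · have : CObj.up 1 (B.enc (letterVar As Γ.length)) = B.encIn As (Γ.length + 1) :=
        encIn_rename_add hB.1 rfl
      rw [this] at hM'
      exact hM'
  | @impElim A B N σ x y p q _ _ ih₁ ih₂ =>
    intro Γ F hΓ hF h
    obtain ⟨cA, cB, hx, hy, hs⟩ := synth_impElim_inv (synth_unlock_inv (check_atom_inv h))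
    have hdec := decodableCtx_encCtx hAs (Γ := Γ)
    obtain ⟨A, hA, rfl⟩ := (check_decode _ hdec cA).1 rfl
    obtain ⟨B, hB, rfl⟩ := (check_decode _ hdec cB).1 rfl
    cases hinj hF hB (T_inj ((Fam.lock.injEq ..).mp hs).2.2.2)
    exact .impE (ih₁ hΓ hA hx) (ih₂ hΓ (Fm.good_imp.2 ⟨hA, hB⟩) hy)
  | @lamIntro A t M p _ ih =>
    intro Γ F hΓ hF h
    obtain ⟨σ, τ, h, hM, hs⟩ := synth_app_inv (check_atom_inv h)
    obtain ⟨G, s, hG, hs₀, hτ⟩ := synth_lamIntro_inv (decodableCtx_encCtx hAs) h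
    cases hτ
    have hm : (Fm.mem s (.set G)).Good As 0 := Fm.good_mem.2 ⟨hs₀, hG⟩
    rw [hsubFam_T_enc hm.1] at hs
    cases hinj hF hm (T_inj hs)
    exact .lamI (ih hΓ (hG.inst hs₀) hM)
  | @lamElim A t M p _ ih =>
    intro Γ F hΓ hF h
    obtain ⟨σ, τ, h, hM, hs⟩ := synth_app_inv (check_atom_inv h)
    obtain ⟨G, s, hG, hs₀, hτ⟩ := synth_lamElim_inv (decodableCtx_encCtx hAs) h
    cases hτ
    rw [hsubFam_T_enc (hG.inst hs₀).1] at hs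
    cases hinj hF (hG.inst hs₀) (T_inj hs)
    exact .lamE (ih hΓ (Fm.good_mem.2 ⟨hs₀, hG⟩) hM)

end Deduction

end FPST

theorem mainTheorem5 (As : List ℕ) (Bs : List FPST.Fm) (A : FPST.Fm)
    (hBs : ∀ B ∈ Bs, B.Closed) (hA : A.Closed) (hnodup : As.Nodup)
    (hAs : ∀ p, p ∈ As ↔ p ∈ A.letters ∨ ∃ B ∈ Bs, p ∈ B.letters) :
    FPST.Provable Bs A ↔
      ∃ M : CLLFP.CObj FPST.names, FPST.NormalizableObj M ∧
        CLLFP.Check FPST.fitch FPST.sig (FPST.encCtx As Bs) M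
          (FPST.T (A.encIn As Bs.length)) := by
  have hBs' : ∀ B ∈ Bs, B.Good As 0 := fun B hB =>
    ⟨hBs B hB, fun p hp => (hAs p).2 (.inr ⟨B, hB, hp⟩)⟩
  have hA' : A.Good As 0 := ⟨hA, fun p hp => (hAs p).2 (.inl hp)⟩
  refine ⟨FPST.Provable.exists_obj hBs' hA', ?_⟩
  rintro ⟨M, ⟨p, hp, hn⟩, hM⟩
  exact ⟨p, hp.quasi hnodup hBs' hA' hM, hn⟩
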